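/- Let $\alpha>\beta>-\tfrac12$ be real, $\rho=\alpha+\beta+1$, and let $\mu$ be the measure $d\mu(t)=\Delta(t)\,dt$ on $\mathbb{R}_+=(0,\infty)$ with $\Delta(t)=(2\sinh t)^{2\alpha+1}(2\cosh t)^{2\beta+1}$. For $\lambda\in\mathbb{R}$ let $$\varphi_\lambda(t)={}_2F_1\bigl(\tfrac12(\rho-i\lambda),\tfrac12(\rho+i\lambda);\alpha+1;-\sinh^2t\bigr)$$ be the Jacobi functions (with ${}_2F_1$ continued analytically to $(-\infty,0]$), let $$\mathbf{c}(\lambda)=\frac{2^{\rho}\,\Gamma(\tfrac12 i\lambda)\,\Gamma(\tfrac12(1+i\lambda))}{\Gamma(\tfrac12(\rho+i\lambda))\,\Gamma(\tfrac12(\rho+i\lambda)-\beta)},$$ and for $R>0$ let $$K_R(t,r)=\int_0^R\varphi_\lambda(t)\varphi_\lambda(r)\,|\mathbf{c}(\lambda)|^{-2}\,d\lambda .$$ Fix $R_0\in(1,\sqrt{\pi/2})$ and put $A_4=\{(t,r): t>R_0,\ 0\le r<R_0/2\}$, $$S_{4,R}f(t)=\int_0^\infty 1_{A_4}(t,r)K_R(t,r)f(r)\,d\mu(r),\qquad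 S_{4,*}f(t)=\sup_{R>0}|S_{4,R}f(t)| .$$ Let $p_0=\frac{4\alpha+4}{2\alpha+3}$, and let $L^{p_0,1}(\mathbb{R}_+,d\mu)$ be the Lorentz space of (classes of) measurable functions $f:\mathbb{R}_+\to\mathbb{C}$ with $\|f\|_{L^{p_0,1}}=\int_0^\infty\mu(\{|f|>s\})^{1/p_0}\,ds<\infty$. Lemma. The maximal operator $S_{4,*}$ is bounded from $L^{p_0,1}(\mathbb{R}_+,d\mu)$ into $L^2(d\mu)$. That is, there is a constant $C<\infty$, depending only on $\alpha,\beta,R_0$, such that for every $f\in L^{p_0,1}(\mathbb{R}_+,d\mu)$ the integrals defining $S_{4,R}f(t)$ converge absolutely for all $R>0$ and all $t$, the function $S_{4,*}f$ belongs to $L^2(d\mu)$, and $$\|S_{4,*}f\|_{L^2(d\mu)}\le C\,\|f\|_{L^{p_0,1}(\mathbb{R}_+,d\mu)} .$$ -/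

import Mathlib

open MeasureTheory Set
open scoped ENNReal NNReal

noncomputable section

namespace JacobiDisc

/-- `ρ = α + β + 1`. -/
def rho (α β : ℝ) : ℝ := α + β + 1

/-- Gauss' hypergeometric function `₂F₁(a, b; c; z)` on the half line `z ≤ 0` of the real axis (and
more generally on the set `{‖z‖ < 1} ∪ {re z < 1/2}`): the hypergeometric series for `‖z‖ < 1`, and
outside the unit disc its analytic continuation
`(1 - z) ^ (-a) * ₂F₁(a, c - b; c; z / (z - 1))`, where the series on the right converges because
`‖z / (z - 1)‖ < 1` as soon as `re z < 1/2`. -/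
def gaussHyp (a b c z : ℂ) : ℂ :=
  open Classical in
  if ‖z‖ < 1 then ordinaryHypergeometric a b c z
  else (1 - z) ^ (-a) * ordinaryHypergeometric a (c - b) c (z / (z - 1))

/-- The Jacobi function
`φ_l(t) = ₂F₁((ρ - i l)/2, (ρ + i l)/2; α + 1; - sinh² t)`. -/
def jacobiPhi (α β l t : ℝ) : ℂ :=
  gaussHyp (((rho α β : ℂ) - Complex.I * l) / 2) (((rho α β : ℂ) + Complex.I * l) / 2)
    ((α : ℂ) + 1) (-((Real.sinh t ^ 2 : ℝ) : ℂ))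

/-- The Harish-Chandra `c`-function
`c(l) = 2^ρ Γ(i l / 2) Γ((1 + i l)/2) / (Γ((ρ + i l)/2) Γ((ρ + i l)/2 - β))`. -/
def cFun (α β l : ℝ) : ℂ :=
  (2 : ℂ) ^ (rho α β : ℂ) * Complex.Gamma (Complex.I * l / 2)
      * Complex.Gamma ((1 + Complex.I * l) / 2) /
    (Complex.Gamma (((rho α β : ℂ) + Complex.I * l) / 2)
      * Complex.Gamma (((rho α β : ℂ) + Complex.I * l) / 2 - β))

/-- The density `Δ(t) = (2 sinh t)^(2α+1) (2 cosh t)^(2β+1)`, `t > 0`. -/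
def Delta (α β t : ℝ) : ℝ :=
  (2 * Real.sinh t) ^ (2 * α + 1) * (2 * Real.cosh t) ^ (2 * β + 1)

/-- The measure `dμ(t) = Δ(t) dt` on `(0, ∞)`, viewed as a measure on `ℝ`. -/
def mu (α β : ℝ) : Measure ℝ :=
  (volume.restrict (Ioi 0)).withDensity fun t => ENNReal.ofReal (Delta α β t)

/-- The kernel of the disc multiplier,
`K_R(t, r) = ∫_0^R φ_l(t) φ_l(r) |c(l)|^(-2) dl`. -/
def kernel (α β R t r : ℝ) : ℂ :=
  ∫ l in (0 : ℝ)..R, jacobiPhi α β l t * jacobiPhi α β l r * (((‖cFun α β l‖ ^ 2)⁻¹ : ℝ) : ℂ)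

/-- The region `A₄ = {(t, r) : t > R₀, 0 ≤ r < R₀ / 2}`. -/
def region4 (R₀ : ℝ) : Set (ℝ × ℝ) := {x | R₀ < x.1 ∧ 0 ≤ x.2 ∧ x.2 < R₀ / 2}

/-- The localized kernel `K_{4,R}(t, r) = 1_{A₄}(t, r) K_R(t, r)`. -/
def kernel4 (α β R₀ R t r : ℝ) : ℂ :=
  (region4 R₀).indicator (fun x => kernel α β R x.1 x.2) (t, r)

/-- `S_{4,R} f(t) = ∫ K_{4,R}(t, r) f(r) dμ(r)`. -/
def S4 (α β R₀ R : ℝ) (f : ℝ → ℂ) (t : ℝ) : ℂ :=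
  ∫ r, kernel4 α β R₀ R t r * f r ∂(mu α β)

/-- The maximal operator `S_{4,*} f(t) = sup_{R > 0} |S_{4,R} f(t)|`, with values in `[0, ∞]`. -/
def S4max (α β R₀ : ℝ) (f : ℝ → ℂ) (t : ℝ) : ℝ≥0∞ :=
  ⨆ R ∈ Ioi (0 : ℝ), ‖S4 α β R₀ R f t‖ₑ

/-- The Lorentz functional, `0 < p < ∞`, `0 < q < ∞`:
`‖f‖_{p,q} = (q ∫_0^∞ [s ν({|f| > s})^(1/p)]^q s⁻¹ ds)^(1/q)`. -/
def lorentzNorm {X : Type*} [MeasurableSpace X] (p q : ℝ) (f : X → ℂ) (ν : Measure X) : ℝ≥0∞ :=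
  (ENNReal.ofReal q * ∫⁻ s in Ioi (0 : ℝ),
    (ENNReal.ofReal s * ν {x | s < ‖f x‖} ^ (1 / p)) ^ q * (ENNReal.ofReal s)⁻¹) ^ (1 / q)

/-- Membership in the Lorentz space `L^{p,q}(X, ν)`. -/
def MemLorentz {X : Type*} [MeasurableSpace X] (p q : ℝ) (f : X → ℂ) (ν : Measure X) : Prop :=
  AEStronglyMeasurable f ν ∧ lorentzNorm p q f ν < ∞

/-- The critical exponent `p₀ = (4α + 4) / (2α + 3)`. -/
def p0 (α : ℝ) : ℝ := (4 * α + 4) / (2 * α + 3)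

end JacobiDisc

end

/-!
The proof rests on a bound for the kernel that is uniform in `R`: for `t > R₀` and `0 < r < R₀ / 2`,
`|K_R(t, r)| ≤ C t⁻¹ Δ(t)^(-1/2) r^(-(α + 1/2))` (`exists_norm_kernel_le`). It dominates the maximal
operator by the product of `t⁻¹ Δ(t)^(-1/2)`, which lies in `L²(μ)`, with the integral of
`r^(-(α + 1/2)) |f(r)|` over `(0, 1)`. The function `r^(-(α + 1/2))` is of weak type `p₀'` near `0`,
so the integral is at most a constant times the `L^{p₀,1}` norm of `f`
(`exists_lintegral_rpow_mul_le`).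

The kernel bound avoids the asymptotic expansions of the Jacobi functions. These functions are
bispectral: besides the differential equation in `t` they satisfy a second-order difference equation
in the spectral variable, with step `2i` and eigenvalue `sinh² t` (`psi_difference_equation`, a
contiguous relation of `₂F₁`). The weight `|c(l)|⁻²` makes the difference operator symmetric
(`diffCoeff_mul_weight`), so that `(sinh² t - sinh² r) φ_l(t) φ_l(r) |c(l)|⁻²` is a difference
`H(l + i) - H(l - i)`, where `H` is odd and holomorphic in the strip `|im l| ≤ 1`. Integration over
`[0, R]` and Cauchy's theorem give a Christoffel–Darboux formula (`sinh_sq_sub_mul_kernel`):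
`(sinh² t - sinh² r) K_R(t, r)` is `i` times the integral of `H(R + i y)` over `-1 ≤ y ≤ 1`.

On this segment `H` is estimated by two ingredients. The first is a pointwise bound for the Jacobi
functions with complex spectral parameter, of order
`(1 + |l|)^(-(α + 1/2)) Δ(t)^(-1/2) (e^(|im l| t) + e^t)` uniformly in `l` and `t`
(`exists_bound_isRegularSol`). It holds for every solution of the Jacobi equation that is regular
at `0`, by integration of the equation from `0` for `t ≲ 1 / |l|` and an energy estimate for the
Liouville normal form beyond; applied to a difference of two solutions it also yields uniqueness,
hence the evenness in `l` and the agreement of the two branches in the definition of `₂F₁`. The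
second is `|Γ(z + δ) / Γ(z)| ≤ C (1 + |z|)^δ` for `re z ≥ 0` (`exists_norm_Gamma_add_le`), which bounds the
weight by `(1 + |l|)^(2α + 1)`. The powers of `R` cancel, the integration in `y` of `e^(|y ± 1| t)`
gains the factor `t⁻¹`, and `sinh² t - sinh² r` absorbs the factor `e^(2t)`.
-/

noncomputable section

namespace JacobiDisc

open Filter Topology

/-! ### Power series with radius of convergence at least one -/

/-- The coefficient sequence `f` defines a power series that converges absolutely in the open unit
disc. -/
def ConvUnit (f : ℕ → ℂ) : Prop := ∀ q : ℝ, 0 ≤ q → q < 1 → Summable fun n => ‖f n‖ * q ^ n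

/-- The coefficients of the derivative of `∑ f n x ^ n`. -/
def derivCoeff (f : ℕ → ℂ) (n : ℕ) : ℂ := (n + 1) * f (n + 1)

/-- The coefficients of `x * ∑ f n x ^ n`. -/
def shiftCoeff (f : ℕ → ℂ) : ℕ → ℂ
  | 0 => 0
  | n + 1 => f n

lemma ConvUnit.hasSum {f : ℕ → ℂ} (hf : ConvUnit f) {x : ℂ} (hx : ‖x‖ < 1) :
    HasSum (fun n => f n * x ^ n) (∑' n, f n * x ^ n) := by
  refine Summable.hasSum (Summable.of_norm ?_)
  simpa [norm_mul, norm_pow] using hf ‖x‖ (norm_nonneg _) hx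

lemma ConvUnit.deriv {f : ℕ → ℂ} (hf : ConvUnit f) : ConvUnit (derivCoeff f) := by
  intro q hq hq1
  obtain ⟨p, hqp, hp1⟩ := exists_between hq1
  have hp : 0 < p := lt_of_le_of_lt hq hqp
  have hr1 : q / p < 1 := (div_lt_one hp).2 hqp
  have hr0 : 0 ≤ q / p := div_nonneg hq hp.le
  have hb : Tendsto (fun n : ℕ => (n : ℝ) * (q / p) ^ n + (q / p) ^ n) atTop (𝓝 (0 + 0)) :=
    (tendsto_self_mul_const_pow_of_lt_one hr0 hr1).add
      (tendsto_pow_atTop_nhds_zero_of_lt_one hr0 hr1)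
  obtain ⟨B, hB⟩ := hb.bddAbove_range
  have hs : Summable fun n => B / p * (‖f (n + 1)‖ * p ^ (n + 1)) :=
    ((summable_nat_add_iff 1).2 (hf p hp.le hp1)).mul_left _
  refine Summable.of_nonneg_of_le (fun n => by positivity) (fun n => ?_) hs
  have h1 : (n : ℝ) * (q / p) ^ n + (q / p) ^ n ≤ B := hB ⟨n, rfl⟩
  have h2 : ‖derivCoeff f n‖ = (n + 1) * ‖f (n + 1)‖ := by
    rw [derivCoeff, norm_mul]
    congr 1
    exact_mod_cast Complex.norm_natCast (n + 1)
  rw [h2]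
  have h3 : B / p * (‖f (n + 1)‖ * p ^ (n + 1)) = B * (‖f (n + 1)‖ * p ^ n) := by
    rw [pow_succ]; field_simp
  have h4 : ((n : ℝ) + 1) * ‖f (n + 1)‖ * q ^ n
      = ((n : ℝ) * (q / p) ^ n + (q / p) ^ n) * (‖f (n + 1)‖ * p ^ n) := by
    rw [div_pow]; field_simp
  rw [h3, h4]
  gcongr

lemma ConvUnit.hasDerivAt {f : ℕ → ℂ} (hf : ConvUnit f) {x : ℂ} (hx : ‖x‖ < 1) :
    HasDerivAt (fun z => ∑' n, f n * z ^ n) (∑' n, derivCoeff f n * x ^ n) x := by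
  obtain ⟨p, hxp, hp1⟩ := exists_between hx
  have hp : 0 ≤ p := (norm_nonneg x).trans hxp.le
  have hs : Summable fun n : ℕ => ‖f n‖ * (n * p ^ (n - 1)) := by
    refine (summable_nat_add_iff 1).1 ?_
    refine (hf.deriv p hp hp1).congr fun n => ?_
    have h2 : ‖derivCoeff f n‖ = (n + 1) * ‖f (n + 1)‖ := by
      rw [derivCoeff, norm_mul]
      congr 1
      exact_mod_cast Complex.norm_natCast (n + 1)
    rw [h2]; push_cast; ring
  have h := hasDerivAt_tsum_of_isPreconnected (𝕜 := ℂ) (t := Metric.ball (0 : ℂ) p)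
    (y₀ := x) (y := x)
    (g := fun n z => f n * z ^ n) (g' := fun n z => f n * (n * z ^ (n - 1))) hs
    Metric.isOpen_ball (convex_ball _ _).isPreconnected
    (fun n y _ => (hasDerivAt_pow n y).const_mul (f n))
    (fun n y hy => by
      have : ‖y‖ < p := by simpa using hy
      rw [norm_mul, norm_mul, norm_pow, Complex.norm_natCast]
      gcongr) (by simpa using hxp) (hf.hasSum hx).summable (by simpa using hxp)
  have hs2 : Summable fun n : ℕ => f n * ((n : ℂ) * x ^ (n - 1)) := by
    refine Summable.of_norm (Summable.of_nonneg_of_le (fun n => norm_nonneg _) (fun n => ?_) hs)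
    rw [norm_mul, norm_mul, norm_pow, Complex.norm_natCast]
    gcongr
  have he : ∑' n, derivCoeff f n * x ^ n = ∑' n, f n * ((n : ℂ) * x ^ (n - 1)) := by
    rw [hs2.tsum_eq_zero_add]
    simp only [derivCoeff, Nat.cast_zero, zero_mul, mul_zero, zero_add, Nat.add_sub_cancel]
    refine tsum_congr fun n => ?_
    push_cast
    ring
  rw [he]
  exact h

lemma hasSum_shiftCoeff {f : ℕ → ℂ} {x s : ℂ} (h : HasSum (fun n => f n * x ^ n) s) :
    HasSum (fun n => shiftCoeff f n * x ^ n) (x * s) := by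
  rw [← hasSum_nat_add_iff' 1]
  simp only [Finset.range_one, Finset.sum_singleton, shiftCoeff, pow_zero, mul_one, sub_zero]
  refine (h.mul_left x).congr_fun ?_
  intro n
  ring

/-! ### The hypergeometric series -/

/-- The Taylor coefficients of `₂F₁(a, b; c; ·)`. -/
def hypCoeff (a b : ℂ) (c : ℝ) (n : ℕ) : ℂ := ordinaryHypergeometricCoefficient a b (c : ℂ) n

/-- `₂F₁(a, b; c; x)` as the sum of its power series, for a real third parameter. -/
def hypF (a b : ℂ) (c : ℝ) (x : ℂ) : ℂ := ∑' n, hypCoeff a b c n * x ^ n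

lemma ordinaryHypergeometric_eq_hypF (a b : ℂ) (c : ℝ) (x : ℂ) :
    ordinaryHypergeometric a b (c : ℂ) x = hypF a b c x := by
  rw [ordinaryHypergeometric_eq_tsum]
  rfl

lemma hypCoeff_zero (a b : ℂ) (c : ℝ) : hypCoeff a b c 0 = 1 := by
  simp [hypCoeff, ordinaryHypergeometricCoefficient]

lemma natCast_add_ofReal_ne_zero {c : ℝ} (hc : 0 < c) (n : ℕ) : ((c : ℂ) + n) ≠ 0 := by
  have : (0 : ℝ) < c + n := by positivity
  exact_mod_cast this.ne'

lemma hypCoeff_succ (a b : ℂ) {c : ℝ} (hc : 0 < c) (n : ℕ) :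
    ((n : ℂ) + 1) * (c + n) * hypCoeff a b c (n + 1) = (a + n) * (b + n) * hypCoeff a b c n := by
  have h1 := natCast_add_ofReal_ne_zero hc n
  have h2 : ((n : ℂ) + 1) ≠ 0 := by exact_mod_cast Nat.succ_ne_zero n
  simp only [hypCoeff, ordinaryHypergeometricCoefficient, ascPochhammer_succ_eval,
    Nat.factorial_succ, mul_inv_rev]
  push_cast
  rw [mul_inv]
  field_simp

/-- Positive majorants of the coefficients `hypCoeff a b c n` for `‖a‖, ‖b‖ ≤ M`. -/
def hypMaj (M c : ℝ) : ℕ → ℝ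
  | 0 => 1
  | n + 1 => (M + n) * (M + n) / ((n + 1) * (c + n)) * hypMaj M c n

lemma hypMaj_pos {M c : ℝ} (hM : 0 < M) (hc : 0 < c) (n : ℕ) : 0 < hypMaj M c n := by
  induction n with
  | zero => simp [hypMaj]
  | succ n ih => rw [hypMaj]; positivity

lemma norm_hypCoeff_le {M c : ℝ} (hM : 0 < M) (hc : 0 < c) {a b : ℂ} (ha : ‖a‖ ≤ M) (hb : ‖b‖ ≤ M)
    (n : ℕ) : ‖hypCoeff a b c n‖ ≤ hypMaj M c n := by
  induction n with
  | zero => simp [hypMaj, hypCoeff_zero]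
  | succ n ih =>
    have h1 := natCast_add_ofReal_ne_zero hc n
    have h2 : ((n : ℂ) + 1) ≠ 0 := by exact_mod_cast Nat.succ_ne_zero n
    have h3 : hypCoeff a b c (n + 1)
        = (a + n) * (b + n) / (((n : ℂ) + 1) * (c + n)) * hypCoeff a b c n := by
      have := hypCoeff_succ a b hc n
      field_simp
      linear_combination this
    have h4 : ‖((n : ℂ) + 1)‖ = n + 1 := by exact_mod_cast Complex.norm_natCast (n + 1)
    have h5 : ‖((c : ℂ) + n)‖ = c + n := by
      have : (0 : ℝ) ≤ c + n := by positivity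
      have h := Complex.norm_of_nonneg this
      push_cast at h
      exact h
    have ha' : ‖a + n‖ ≤ M + n := (norm_add_le _ _).trans (by simpa using ha)
    have hb' : ‖b + n‖ ≤ M + n := (norm_add_le _ _).trans (by simpa using hb)
    rw [h3, norm_mul, norm_div, norm_mul, norm_mul, h4, h5, hypMaj]
    gcongr

lemma summable_hypMaj {M c : ℝ} (hM : 0 < M) (hc : 0 < c) {q : ℝ} (hq : 0 < q) (hq1 : q < 1) :
    Summable fun n => hypMaj M c n * q ^ n := by
  have hpos := hypMaj_pos hM hc
  refine summable_of_ratio_test_tendsto_lt_one hq1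
    (Eventually.of_forall fun n => (mul_pos (hpos n) (pow_pos hq n)).ne') ?_
  have h1 : Tendsto (fun n : ℕ => ((M + (1 : ℝ) * n) / (1 + (1 : ℝ) * n)) *
      ((M + (1 : ℝ) * n) / (c + (1 : ℝ) * n)) * q) atTop (𝓝 ((1 / 1) * (1 / 1) * q)) :=
    (((tendsto_add_mul_div_add_mul_atTop_nhds _ _ _ one_ne_zero).mul
      (tendsto_add_mul_div_add_mul_atTop_nhds _ _ _ one_ne_zero)).mul_const q)
  simp only [div_one, one_mul] at h1
  refine h1.congr fun n => ?_
  have := hpos n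
  rw [Real.norm_of_nonneg (by have := hpos (n + 1); positivity),
    Real.norm_of_nonneg (by positivity), hypMaj, pow_succ]
  field_simp
  ring

lemma convUnit_hypCoeff (a b : ℂ) {c : ℝ} (hc : 0 < c) : ConvUnit (hypCoeff a b c) := by
  intro q hq hq1
  have hM : 0 < max ‖a‖ ‖b‖ + 1 := by positivity
  have ha : ‖a‖ ≤ max ‖a‖ ‖b‖ + 1 := (le_max_left _ _).trans (by linarith)
  have hb : ‖b‖ ≤ max ‖a‖ ‖b‖ + 1 := (le_max_right _ _).trans (by linarith)
  obtain ⟨p, hqp, hp1⟩ := exists_between hq1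
  refine Summable.of_nonneg_of_le (fun n => by positivity) (fun n => ?_)
    (summable_hypMaj hM hc (hq.trans_lt hqp) hp1)
  have := norm_hypCoeff_le hM hc ha hb n
  gcongr
  exact this.trans' (norm_nonneg _)

/-- The first derivative of the hypergeometric series. -/
def hypF' (a b : ℂ) (c : ℝ) (x : ℂ) : ℂ := ∑' n, derivCoeff (hypCoeff a b c) n * x ^ n

/-- The second derivative of the hypergeometric series. -/
def hypF'' (a b : ℂ) (c : ℝ) (x : ℂ) : ℂ := ∑' n, derivCoeff (derivCoeff (hypCoeff a b c)) n * x ^ n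

lemma hasDerivAt_hypF (a b : ℂ) {c : ℝ} (hc : 0 < c) {x : ℂ} (hx : ‖x‖ < 1) :
    HasDerivAt (hypF a b c) (hypF' a b c x) x :=
  (convUnit_hypCoeff a b hc).hasDerivAt hx

lemma hasDerivAt_hypF' (a b : ℂ) {c : ℝ} (hc : 0 < c) {x : ℂ} (hx : ‖x‖ < 1) :
    HasDerivAt (hypF' a b c) (hypF'' a b c x) x :=
  (convUnit_hypCoeff a b hc).deriv.hasDerivAt hx

lemma hypF_zero (a b : ℂ) (c : ℝ) : hypF a b c 0 = 1 := by
  rw [← ordinaryHypergeometric_eq_hypF, ordinaryHypergeometric_zero]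

/-- The hypergeometric differential equation. -/
lemma hypF_ode (a b : ℂ) {c : ℝ} (hc : 0 < c) {x : ℂ} (hx : ‖x‖ < 1) :
    x * (1 - x) * hypF'' a b c x + (c - (a + b + 1) * x) * hypF' a b c x
      - a * b * hypF a b c x = 0 := by
  have hf := convUnit_hypCoeff a b hc
  have h0 : HasSum _ (hypF a b c x) := hf.hasSum hx
  have h1 : HasSum _ (hypF' a b c x) := hf.deriv.hasSum hx
  have h2 : HasSum _ (hypF'' a b c x) := hf.deriv.deriv.hasSum hx
  have h3 := hasSum_shiftCoeff h1
  have h4 := hasSum_shiftCoeff h2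
  have h5 := hasSum_shiftCoeff h4
  have key := (((h4.sub h5).add (h1.mul_left (c : ℂ))).sub (h3.mul_left (a + b + 1))).sub
    (h0.mul_left (a * b))
  have hz : HasSum (fun _ : ℕ => (0 : ℂ)) _ := hasSum_zero
  have := hz.unique (key.congr_fun fun n => ?_)
  · linear_combination -this
  · have hr := hypCoeff_succ a b hc n
    match n with
    | 0 => simp [shiftCoeff, derivCoeff] at hr ⊢; linear_combination -hr
    | 1 => simp [shiftCoeff, derivCoeff] at hr ⊢; linear_combination -hr * x
    | n + 2 =>
      simp only [shiftCoeff, derivCoeff] at hr ⊢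
      push_cast at hr ⊢
      linear_combination -hr * x ^ (n + 2)

/-- Raising both upper parameters multiplies the coefficients by `(a + n) (b + n) / (a b)`. Stated
without division, since `a b` may vanish. -/
lemma mul_hypCoeff_add_one (a b : ℂ) {c : ℝ} (hc : 0 < c) (n : ℕ) :
    a * b * hypCoeff (a + 1) (b + 1) c n = (a + n) * (b + n) * hypCoeff a b c n := by
  induction n with
  | zero => simp [hypCoeff_zero]
  | succ n ih =>
    have h1 := natCast_add_ofReal_ne_zero hc n
    have h2 : ((n : ℂ) + 1) ≠ 0 := by exact_mod_cast Nat.succ_ne_zero n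
    have h3 := hypCoeff_succ a b hc n
    have h4 := hypCoeff_succ (a + 1) (b + 1) hc n
    refine mul_left_cancel₀ (mul_ne_zero h2 h1) ?_
    push_cast
    linear_combination a * b * h4 + (a + 1 + n) * (b + 1 + n) * ih
      - (a + 1 + n) * (b + 1 + n) * h3

lemma hypCoeff_sub_one_succ (a b : ℂ) {c : ℝ} (hc : 0 < c) (n : ℕ) :
    ((n : ℂ) + 1) * (c + n) * hypCoeff (a - 1) (b - 1) c (n + 1)
      = (a - 1) * (b - 1) * hypCoeff a b c n := by
  have h := mul_hypCoeff_add_one (a - 1) (b - 1) hc n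
  rw [sub_add_cancel, sub_add_cancel] at h
  rw [hypCoeff_succ _ _ hc, h]

/-- A three-term contiguous relation that shifts both upper parameters in the same direction. After
the coefficients of the shifted series have been expressed through those of `hypF a b c`, it is a
rational identity in each degree. -/
lemma hypF_contiguous (a b : ℂ) {c : ℝ} (hc : 0 < c) {x s : ℂ} (hx : ‖x‖ < 1)
    (hs : s = c - a - b) (h0 : s ≠ 0) (h1 : s - 1 ≠ 0) (h2 : s + 1 ≠ 0) :
    a * b / (s * (s - 1)) * ((1 - x) ^ 2 * hypF (a + 1) (b + 1) c x - (1 - x) * hypF a b c x)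
      + (c - b) * (c - a) / (s * (s + 1)) *
        (hypF (a - 1) (b - 1) c x - (1 - x) * hypF a b c x) = x * hypF a b c x := by
  have f0 : HasSum _ (hypF a b c x) := (convUnit_hypCoeff a b hc).hasSum hx
  have g0 : HasSum _ (hypF (a + 1) (b + 1) c x) := (convUnit_hypCoeff (a + 1) (b + 1) hc).hasSum hx
  have k0 : HasSum _ (hypF (a - 1) (b - 1) c x) := (convUnit_hypCoeff (a - 1) (b - 1) hc).hasSum hx
  have f1 := hasSum_shiftCoeff f0
  have g1 := hasSum_shiftCoeff g0
  have g2 := hasSum_shiftCoeff g1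
  have key := (((((g0.sub (g1.mul_left 2)).add g2).sub (f0.sub f1)).mul_left
    (a * b / (s * (s - 1)))).add ((k0.sub (f0.sub f1)).mul_left
      ((c - b) * (c - a) / (s * (s + 1))))).sub f1
  have hz : HasSum (fun _ : ℕ => (0 : ℂ)) _ := hasSum_zero
  have := hz.unique (key.congr_fun fun n => ?_)
  · linear_combination -this
  · have hgn := mul_hypCoeff_add_one a b hc
    have hkn := hypCoeff_sub_one_succ a b hc
    have hfn := hypCoeff_succ a b hc
    have hfn' : ∀ n : ℕ, hypCoeff a b c (n + 1)
        = (a + n) * (b + n) * hypCoeff a b c n / (((n : ℂ) + 1) * (c + n)) := fun n => by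
      rw [eq_div_iff (mul_ne_zero (by exact_mod_cast Nat.succ_ne_zero n)
        (natCast_add_ofReal_ne_zero hc n)), ← hfn n]
      ring
    have hkn' : ∀ n : ℕ, hypCoeff (a - 1) (b - 1) c (n + 1)
        = (a - 1) * (b - 1) * hypCoeff a b c n / (((n : ℂ) + 1) * (c + n)) := fun n => by
      rw [eq_div_iff (mul_ne_zero (by exact_mod_cast Nat.succ_ne_zero n)
        (natCast_add_ofReal_ne_zero hc n)), ← hkn n]
      ring
    have hn1 : ∀ n : ℕ, ((n : ℂ) + 1) ≠ 0 := fun n => by exact_mod_cast Nat.succ_ne_zero n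
    subst hs
    match n with
    | 0 =>
      simp only [shiftCoeff, hypCoeff_zero]
      field_simp
      ring
    | 1 =>
      have e0 := natCast_add_ofReal_ne_zero hc 0
      have r1 := hgn 1
      rw [hfn' 0] at r1
      simp only [shiftCoeff]
      rw [hkn' 0, hfn' 0]
      simp only [hypCoeff_zero, Nat.cast_zero, add_zero, zero_add, Nat.cast_one, one_mul, mul_one]
        at r1 e0 ⊢
      have hX : a * b / ((c - a - b) * (c - a - b - 1)) * hypCoeff (a + 1) (b + 1) c 1
          = (a + 1) * (b + 1) * (a * b / c) / ((c - a - b) * (c - a - b - 1)) := by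
        rw [← r1]; ring
      have hX' : ∀ y : ℂ, a * b / ((c - a - b) * (c - a - b - 1)) *
          (hypCoeff (a + 1) (b + 1) c 1 - y)
          = ((a + 1) * (b + 1) * (a * b / c) - a * b * y) / ((c - a - b) * (c - a - b - 1)) :=
        fun y => by rw [mul_sub, hX]; ring
      have hZ := hX' (2 + (a * b / c - 1))
      have hW : ((a + 1) * (b + 1) * (a * b / c) - a * b * (2 + (a * b / c - 1))) /
          ((c - a - b) * (c - a - b - 1)) + (c - b) * (c - a) / ((c - a - b) * (c - a - b + 1)) *
          ((a - 1) * (b - 1) / c - (a * b / c - 1)) - 1 = 0 := by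
        field_simp
        ring
      linear_combination -(hZ + hW) * x
    | n + 2 =>
      have e0 := natCast_add_ofReal_ne_zero hc n
      have e1 := natCast_add_ofReal_ne_zero hc (n + 1)
      have m0 := hn1 n
      have m1 := hn1 (n + 1)
      have r2 := hgn (n + 2)
      have r1 := hgn (n + 1)
      have r0 := hgn n
      rw [hfn' (n + 1), hfn' n] at r2
      rw [hfn' n] at r1
      simp only [shiftCoeff]
      rw [hkn' (n + 1), hfn' (n + 1), hfn' n]
      push_cast at *
      have hX : ∀ y : ℂ, a * b / ((c - a - b) * (c - a - b - 1)) *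
          (hypCoeff (a + 1) (b + 1) c (n + 2) - 2 * hypCoeff (a + 1) (b + 1) c (n + 1)
            + hypCoeff (a + 1) (b + 1) c n - y)
          = (a * b * hypCoeff (a + 1) (b + 1) c (n + 2)
          - 2 * (a * b * hypCoeff (a + 1) (b + 1) c (n + 1)) + a * b * hypCoeff (a + 1) (b + 1) c n
          - a * b * y) / ((c - a - b) * (c - a - b - 1)) := fun y => by ring
      rw [r2, r1, r0] at hX
      have hZ := hX ((a + (n + 1)) * (b + (n + 1)) * ((a + n) * (b + n) * hypCoeff a b c n /
        ((n + 1) * (c + n))) / ((n + 1 + 1) * (c + (n + 1)))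
        - (a + n) * (b + n) * hypCoeff a b c n / ((n + 1) * (c + n)))
      have hW : ((a + (n + 2)) * (b + (n + 2)) * ((a + (n + 1)) * (b + (n + 1)) *
          ((a + n) * (b + n) / ((n + 1) * (c + n))) / ((n + 1 + 1) * (c + (n + 1))))
          - 2 * ((a + (n + 1)) * (b + (n + 1)) * ((a + n) * (b + n) / ((n + 1) * (c + n))))
          + (a + n) * (b + n) - a * b * ((a + (n + 1)) * (b + (n + 1)) * ((a + n) * (b + n) /
          ((n + 1) * (c + n))) / ((n + 1 + 1) * (c + (n + 1)))
          - (a + n) * (b + n) / ((n + 1) * (c + n)))) / ((c - a - b) * (c - a - b - 1))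
          + (c - b) * (c - a) / ((c - a - b) * (c - a - b + 1)) *
          ((a - 1) * (b - 1) * ((a + n) * (b + n) / ((n + 1) * (c + n))) /
            ((n + 1 + 1) * (c + (n + 1)))
          - ((a + (n + 1)) * (b + (n + 1)) * ((a + n) * (b + n) /
          ((n + 1) * (c + n))) / ((n + 1 + 1) * (c + (n + 1)))
          - (a + n) * (b + n) / ((n + 1) * (c + n)))) - (a + n) * (b + n) / ((n + 1) * (c + n))
          = 0 := by
        field_simp
        ring
      linear_combination -(hZ + hW * hypCoeff a b c n) * x ^ (n + 2)

/-! ### Dependence of the hypergeometric series on its parameters -/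

lemma norm_hypCoeff_mul_pow_le {M c q : ℝ} (hM : 0 < M) (hc : 0 < c) {a b x : ℂ}
    (ha : ‖a‖ ≤ M) (hb : ‖b‖ ≤ M) (hx : ‖x‖ ≤ q) (n : ℕ) :
    ‖hypCoeff a b c n * x ^ n‖ ≤ hypMaj M c n * q ^ n := by
  rw [norm_mul, norm_pow]
  have := (hypMaj_pos hM hc n).le
  have := norm_hypCoeff_le hM hc ha hb n
  gcongr

/-- Joint continuity in both upper parameters and the variable. -/
lemma continuousAt_hypF {c : ℝ} (hc : 0 < c) (p : ℂ × ℂ × ℂ) (hp : ‖p.2.2‖ < 1) :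
    ContinuousAt (fun p : ℂ × ℂ × ℂ => hypF p.1 p.2.1 c p.2.2) p := by
  obtain ⟨q, hxq, hq1⟩ := exists_between hp
  have hq : 0 < q := (norm_nonneg _).trans_lt hxq
  obtain ⟨M, hM⟩ := exists_gt (max ‖p.1‖ ‖p.2.1‖)
  have hM0 : 0 < M := ((norm_nonneg _).trans (le_max_left _ _)).trans_lt hM
  let U : Set (ℂ × ℂ × ℂ) := {p | ‖p.1‖ < M ∧ ‖p.2.1‖ < M ∧ ‖p.2.2‖ < q}
  have h1 : IsOpen {p : ℂ × ℂ × ℂ | ‖p.1‖ < M} := isOpen_lt (by fun_prop) continuous_const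
  have h2 : IsOpen {p : ℂ × ℂ × ℂ | ‖p.2.1‖ < M} := isOpen_lt (by fun_prop) continuous_const
  have h3 : IsOpen {p : ℂ × ℂ × ℂ | ‖p.2.2‖ < q} := isOpen_lt (by fun_prop) continuous_const
  have hU : IsOpen U := h1.inter (h2.inter h3)
  have hpU : p ∈ U := ⟨(le_max_left _ _).trans_lt hM, (le_max_right _ _).trans_lt hM, hxq⟩
  refine ContinuousOn.continuousAt (s := U) ?_ (hU.mem_nhds hpU)
  refine continuousOn_tsum (fun n => ?_) (summable_hypMaj hM0 hc hq hq1)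
    (fun n p hp => norm_hypCoeff_mul_pow_le hM0 hc hp.1.le hp.2.1.le hp.2.2.le n)
  unfold hypCoeff ordinaryHypergeometricCoefficient
  fun_prop

lemma differentiable_hypF {c : ℝ} (hc : 0 < c) {a b : ℂ → ℂ} (ha : Differentiable ℂ a)
    (hb : Differentiable ℂ b) {x : ℂ} (hx : ‖x‖ < 1) :
    Differentiable ℂ fun z => hypF (a z) (b z) c x := by
  intro z
  obtain ⟨q, hxq, hq1⟩ := exists_between hx
  have hq : 0 < q := (norm_nonneg _).trans_lt hxq
  obtain ⟨M, hM⟩ := exists_gt (max ‖a z‖ ‖b z‖)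
  have hM0 : 0 < M := ((norm_nonneg _).trans (le_max_left _ _)).trans_lt hM
  let U : Set ℂ := {z | ‖a z‖ < M ∧ ‖b z‖ < M}
  have hU : IsOpen U := (isOpen_lt ha.continuous.norm continuous_const).inter
    (isOpen_lt hb.continuous.norm continuous_const)
  have hzU : z ∈ U := ⟨(le_max_left _ _).trans_lt hM, (le_max_right _ _).trans_lt hM⟩
  refine DifferentiableOn.differentiableAt (s := U) ?_ (hU.mem_nhds hzU)
  refine Complex.differentiableOn_tsum_of_summable_norm (summable_hypMaj hM0 hc hq hq1)
    (fun n => Differentiable.differentiableOn ?_) hU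
    (fun n p hp => norm_hypCoeff_mul_pow_le hM0 hc hp.1.le hp.2.le hxq.le n)
  unfold hypCoeff ordinaryHypergeometricCoefficient
  have h1 : Differentiable ℂ fun z => (ascPochhammer ℂ n).eval (a z) :=
    (ascPochhammer ℂ n).differentiable.comp ha
  have h2 : Differentiable ℂ fun z => (ascPochhammer ℂ n).eval (b z) :=
    (ascPochhammer ℂ n).differentiable.comp hb
  fun_prop

/-! ### Regular solutions of the Jacobi differential equation -/

/-- The logarithmic derivative of `Delta α β`. -/
def damping (α β t : ℝ) : ℝ :=
  (2 * α + 1) * (Real.cosh t / Real.sinh t) + (2 * β + 1) * (Real.sinh t / Real.cosh t)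

/-- The square root of `Delta α β t`. -/
def sqrtDelta (α β t : ℝ) : ℝ :=
  (2 * Real.sinh t) ^ (α + 1 / 2) * (2 * Real.cosh t) ^ (β + 1 / 2)

/-- `y` solves `y'' + (Δ' / Δ) y' + (ρ² + l²) y = 0` on `(0, T)` with derivative `y'`, and is
regular at the singular point `0`. The spectral parameter `l` may be complex. -/
structure IsRegularSol (α β : ℝ) (l : ℂ) (T : ℝ) (y y' : ℝ → ℂ) : Prop where
  cont : ContinuousOn y (Ico 0 T)
  deriv : ∀ t ∈ Ioo 0 T, HasDerivAt y (y' t) t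
  ode : ∀ t ∈ Ioo 0 T,
    HasDerivAt y' (-(damping α β t : ℂ) * y' t - ((rho α β : ℂ) ^ 2 + l ^ 2) * y t) t
  lim : Tendsto (fun t => (Delta α β t : ℂ) * y' t) (𝓝[>] 0) (𝓝 0)

section

variable {α β : ℝ}

lemma sqrtDelta_pos {t : ℝ} (ht : 0 < t) : 0 < sqrtDelta α β t := by
  have := Real.sinh_pos_iff.2 ht
  have := Real.cosh_pos t
  unfold sqrtDelta
  positivity

lemma sqrtDelta_sq {t : ℝ} (ht : 0 < t) : sqrtDelta α β t ^ 2 = Delta α β t := by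
  have h1 : 0 < 2 * Real.sinh t := by have := Real.sinh_pos_iff.2 ht; positivity
  have h2 : 0 < 2 * Real.cosh t := by have := Real.cosh_pos t; positivity
  rw [sqrtDelta, Delta, mul_pow, ← Real.rpow_natCast, ← Real.rpow_natCast, ← Real.rpow_mul h1.le,
    ← Real.rpow_mul h2.le]
  congr 2 <;> push_cast <;> ring

lemma Delta_pos {t : ℝ} (ht : 0 < t) : 0 < Delta α β t := by
  rw [← sqrtDelta_sq ht]
  have := sqrtDelta_pos (α := α) (β := β) ht
  positivity

lemma hasDerivAt_sqrtDelta {t : ℝ} (ht : 0 < t) :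
    HasDerivAt (sqrtDelta α β) (damping α β t / 2 * sqrtDelta α β t) t := by
  have hs := Real.sinh_pos_iff.2 ht
  have hc := Real.cosh_pos t
  have h1 : HasDerivAt (fun t => (2 * Real.sinh t) ^ (α + 1 / 2)) _ t :=
    ((Real.hasDerivAt_sinh t).const_mul 2).rpow_const (Or.inl (by positivity))
  have h2 : HasDerivAt (fun t => (2 * Real.cosh t) ^ (β + 1 / 2)) _ t :=
    ((Real.hasDerivAt_cosh t).const_mul 2).rpow_const (Or.inl (by positivity))
  refine (h1.mul h2).congr_deriv ?_
  rw [Real.rpow_sub_one (by positivity), Real.rpow_sub_one (by positivity), damping, sqrtDelta]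
  field_simp

lemma hasDerivAt_Delta {t : ℝ} (ht : 0 < t) :
    HasDerivAt (Delta α β) (damping α β t * Delta α β t) t := by
  have h := (hasDerivAt_sqrtDelta (α := α) (β := β) ht).pow 2
  have h' : HasDerivAt (Delta α β) (((2 : ℕ) : ℝ) * sqrtDelta α β t ^ (2 - 1) *
      (damping α β t / 2 * sqrtDelta α β t)) t := by
    refine h.congr_of_eventuallyEq ?_
    filter_upwards [lt_mem_nhds ht] with s hs
    exact (sqrtDelta_sq hs).symm
  convert h' using 1
  rw [← sqrtDelta_sq ht]
  push_cast
  ring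

lemma hasDerivAt_damping {t : ℝ} (ht : 0 < t) :
    HasDerivAt (damping α β)
      (-(2 * α + 1) / Real.sinh t ^ 2 + (2 * β + 1) / Real.cosh t ^ 2) t := by
  have hs := Real.sinh_pos_iff.2 ht
  have hc := Real.cosh_pos t
  have h1 := ((Real.hasDerivAt_cosh t).div (Real.hasDerivAt_sinh t) hs.ne').const_mul (2 * α + 1)
  have h2 := ((Real.hasDerivAt_sinh t).div (Real.hasDerivAt_cosh t) hc.ne').const_mul (2 * β + 1)
  refine (h1.add h2).congr_deriv ?_
  have h := Real.cosh_sq t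
  field_simp
  rw [h]
  ring

lemma sqrtDelta_mono (hα : -(1 / 2) < α) (hβ : -(1 / 2) < β) {s t : ℝ} (hs : 0 < s) (hst : s ≤ t) :
    sqrtDelta α β s ≤ sqrtDelta α β t := by
  have h1 := Real.sinh_pos_iff.2 hs
  have h2 := Real.sinh_le_sinh.2 hst
  have h3 := Real.cosh_pos s
  have h4 : Real.cosh s ≤ Real.cosh t := by
    rw [Real.cosh_le_cosh, abs_of_pos hs, abs_of_pos (hs.trans_le hst)]; exact hst
  have h5 : 0 ≤ α + 1 / 2 := by linarith
  have h6 : 0 ≤ β + 1 / 2 := by linarith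
  have h7 : 0 < Real.sinh t := h1.trans_le h2
  unfold sqrtDelta
  gcongr

lemma Delta_mono (hα : -(1 / 2) < α) (hβ : -(1 / 2) < β) {s t : ℝ} (hs : 0 < s) (hst : s ≤ t) :
    Delta α β s ≤ Delta α β t := by
  rw [← sqrtDelta_sq hs, ← sqrtDelta_sq (hs.trans_le hst)]
  have := sqrtDelta_mono hα hβ hs hst
  have := sqrtDelta_pos (α := α) (β := β) hs
  gcongr

variable {l : ℂ} {T : ℝ} {y y' : ℝ → ℂ}

lemma IsRegularSol.hasDerivAt_Delta_mul (h : IsRegularSol α β l T y y') {t : ℝ}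
    (ht : t ∈ Ioo 0 T) : HasDerivAt (fun t => (Delta α β t : ℂ) * y' t)
      (-((rho α β : ℂ) ^ 2 + l ^ 2) * Delta α β t * y t) t := by
  have h1 := (hasDerivAt_Delta (α := α) (β := β) ht.1).ofReal_comp
  refine (h1.mul (h.ode t ht)).congr_deriv ?_
  push_cast
  ring

/-- As long as `|ρ² + l²| t² ≤ 1 / 2`, a regular solution stays comparable to its initial value: by
`(Δ y')' = -(ρ² + l²) Δ y` and the monotonicity of `Δ`, `|y' s| ≤ |ρ² + l²| s sup |y|`. -/
lemma IsRegularSol.norm_le_of_small (hα : -(1 / 2) < α) (hβ : -(1 / 2) < β)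
    (h : IsRegularSol α β l T y y') {t : ℝ}
    (ht : t ∈ Ioo 0 T) (hM : ‖(rho α β : ℂ) ^ 2 + l ^ 2‖ * t ^ 2 ≤ 1 / 2) :
    ‖y t‖ ≤ 2 * ‖y 0‖ ∧ ‖y' t‖ ≤ 2 * ‖(rho α β : ℂ) ^ 2 + l ^ 2‖ * t * ‖y 0‖ := by
  set M := (rho α β : ℂ) ^ 2 + l ^ 2
  have hsub : Icc 0 t ⊆ Ico 0 T := fun s hs => ⟨hs.1, hs.2.trans_lt ht.2⟩
  obtain ⟨s₀, hs₀, hmax⟩ := isCompact_Icc.exists_isMaxOn (nonempty_Icc.2 ht.1.le)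
    (h.cont.mono hsub).norm
  set Y := ‖y s₀‖
  have hY : ∀ s ∈ Icc 0 t, ‖y s‖ ≤ Y := fun s hs => hmax hs
  have hd : ∀ s ∈ Ioc 0 t, ‖y' s‖ ≤ ‖M‖ * s * Y := by
    intro s hs
    have hD : 0 < Delta α β s := Delta_pos hs.1
    have h1 : ∀ ε ∈ Ioo 0 s,
        ‖(Delta α β s : ℂ) * y' s - Delta α β ε * y' ε‖ ≤ ‖M‖ * Delta α β s * Y * s := by
      intro ε hε
      have h2 := norm_image_sub_le_of_norm_deriv_le_segment' (a := ε) (b := s)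
        (f := fun t => (Delta α β t : ℂ) * y' t) (C := ‖M‖ * Delta α β s * Y)
        (fun x hx => (h.hasDerivAt_Delta_mul
          ⟨hε.1.trans_le hx.1, (hx.2.trans hs.2).trans_lt ht.2⟩).hasDerivWithinAt)
        (fun x hx => ?_) s (right_mem_Icc.2 hε.2.le)
      · refine h2.trans ?_
        have : 0 ≤ Y := norm_nonneg _
        gcongr
        linarith [hε.1]
      · have hx0 := hε.1.trans_le hx.1
        rw [norm_mul, norm_mul, norm_neg, Complex.norm_of_nonneg (Delta_pos hx0).le]
        have := Delta_mono (α := α) (β := β) hα hβ hx0 hx.2.le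
        have := hY x ⟨hx0.le, hx.2.le.trans hs.2⟩
        have := (Delta_pos (α := α) (β := β) hx0).le
        gcongr
    have h3 : Tendsto (fun ε => ‖(Delta α β s : ℂ) * y' s - Delta α β ε * y' ε‖) (𝓝[>] 0)
        (𝓝 ‖(Delta α β s : ℂ) * y' s - 0‖) := (tendsto_const_nhds.sub h.lim).norm
    have h4 := le_of_tendsto h3 (by
      filter_upwards [Ioo_mem_nhdsGT hs.1] with ε hε using h1 ε hε)
    rw [sub_zero, norm_mul, Complex.norm_of_nonneg hD.le] at h4
    refine le_of_mul_le_mul_left (h4.trans (le_of_eq ?_)) hD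
    ring
  -- on `[0, t]` the oscillation of `y` is at most `|ρ² + l²| t² Y ≤ Y / 2`
  have hY2 : Y ≤ 2 * ‖y 0‖ := by
    rcases hs₀.1.eq_or_lt with h0 | h0
    · have : Y = ‖y 0‖ := by simp only [Y, ← h0]
      linarith [norm_nonneg (y 0)]
    have h1 : ∀ ε ∈ Ioo 0 s₀, ‖y s₀ - y ε‖ ≤ Y / 2 := by
      intro ε hε
      have h2 := norm_image_sub_le_of_norm_deriv_le_segment' (a := ε) (b := s₀)
        (f := y) (f' := y') (C := ‖M‖ * t * Y)
        (fun x hx => (h.deriv x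
          ⟨hε.1.trans_le hx.1, (hx.2.trans hs₀.2).trans_lt ht.2⟩).hasDerivWithinAt)
        (fun x hx => ?_) s₀ (right_mem_Icc.2 hε.2.le)
      · refine h2.trans ?_
        have hY0 : 0 ≤ Y := norm_nonneg _
        have h5 : ‖M‖ * t * Y * (s₀ - ε) ≤ ‖M‖ * t * Y * t := by
          have := ht.1.le
          gcongr
          linarith [hε.1, hs₀.2]
        nlinarith
      · refine (hd x ⟨hε.1.trans_le hx.1, hx.2.le.trans hs₀.2⟩).trans ?_
        have : x ≤ t := hx.2.le.trans hs₀.2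
        have : 0 ≤ Y := norm_nonneg _
        gcongr
    have hc : Tendsto y (𝓝[>] 0) (𝓝 (y 0)) := by
      refine (h.cont 0 ⟨le_rfl, ht.1.trans ht.2⟩).mono_left ?_
      refine nhdsWithin_le_iff.2 ?_
      filter_upwards [Ioo_mem_nhdsGT (ht.1.trans ht.2)] with x hx using ⟨hx.1.le, hx.2⟩
    have h3 : Tendsto (fun ε => ‖y s₀ - y ε‖) (𝓝[>] 0) (𝓝 ‖y s₀ - y 0‖) :=
      (tendsto_const_nhds.sub hc).norm
    have h4 := le_of_tendsto h3 (by
      filter_upwards [Ioo_mem_nhdsGT h0] with ε hε using h1 ε hε)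
    have h5 : Y ≤ ‖y s₀ - y 0‖ + ‖y 0‖ := by
      simpa using norm_add_le (y s₀ - y 0) (y 0)
    linarith
  refine ⟨(hY t ⟨ht.1.le, le_rfl⟩).trans hY2, (hd t ⟨ht.1, le_rfl⟩).trans ?_⟩
  have := ht.1.le
  calc ‖M‖ * t * Y ≤ ‖M‖ * t * (2 * ‖y 0‖) := by gcongr
    _ = _ := by ring

/-- The potential in the Liouville normal form `u'' = (V - l²) u` of the Jacobi equation, where
`u = Δ ^ (1 / 2) y`. -/
def potential (α β t : ℝ) : ℝ :=
  (α ^ 2 - 1 / 4) / Real.sinh t ^ 2 - (β ^ 2 - 1 / 4) / Real.cosh t ^ 2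

lemma abs_potential_le (α β : ℝ) {t : ℝ} (ht : 0 < t) :
    |potential α β t| ≤ (|α ^ 2 - 1 / 4| + |β ^ 2 - 1 / 4|) / Real.sinh t ^ 2 := by
  have hs := Real.sinh_pos_iff.2 ht
  have hc : Real.sinh t ^ 2 ≤ Real.cosh t ^ 2 := by rw [Real.cosh_sq]; linarith
  have hs2 : 0 < Real.sinh t ^ 2 := by positivity
  unfold potential
  rw [add_div]
  refine (abs_sub _ _).trans ?_
  rw [abs_div, abs_div, abs_of_pos hs2, abs_of_pos (hs2.trans_le hc)]
  gcongr

/-- The potential in terms of `Δ' / Δ` and its derivative, as it arises in the Liouville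
transformation. -/
lemma potential_eq {t : ℝ} (ht : 0 < t) : potential α β t = damping α β t ^ 2 / 4 +
    (-(2 * α + 1) / Real.sinh t ^ 2 + (2 * β + 1) / Real.cosh t ^ 2) / 2 - rho α β ^ 2 := by
  have hs := Real.sinh_pos_iff.2 ht
  have hc := Real.cosh_pos t
  have h := Real.cosh_sq t
  unfold potential damping rho
  have h4 : Real.cosh t ^ 4 = (Real.sinh t ^ 2 + 1) ^ 2 := by rw [← h]; ring
  field_simp
  ring_nf
  rw [h4, h]
  ring

/-- The function `Δ ^ (1 / 2) y`. -/
def liouville (α β : ℝ) (y : ℝ → ℂ) (t : ℝ) : ℂ := (sqrtDelta α β t : ℂ) * y t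

/-- The derivative of `Δ ^ (1 / 2) y`, when `y'` is the derivative of `y`. -/
def liouville' (α β : ℝ) (y y' : ℝ → ℂ) (t : ℝ) : ℂ :=
  (sqrtDelta α β t : ℂ) * (y' t + (damping α β t / 2 : ℝ) * y t)

lemma IsRegularSol.hasDerivAt_liouville (h : IsRegularSol α β l T y y') {t : ℝ}
    (ht : t ∈ Ioo 0 T) : HasDerivAt (liouville α β y) (liouville' α β y y' t) t := by
  have h1 := (hasDerivAt_sqrtDelta (α := α) (β := β) ht.1).ofReal_comp
  refine (h1.mul (h.deriv t ht)).congr_deriv ?_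
  rw [liouville']
  push_cast
  ring

lemma IsRegularSol.hasDerivAt_liouville' (h : IsRegularSol α β l T y y') {t : ℝ}
    (ht : t ∈ Ioo 0 T) : HasDerivAt (liouville' α β y y')
      (((potential α β t : ℂ) - l ^ 2) * liouville α β y t) t := by
  have h1 := (hasDerivAt_sqrtDelta (α := α) (β := β) ht.1).ofReal_comp
  have h2 := ((hasDerivAt_damping (α := α) (β := β) ht.1).div_const 2).ofReal_comp
  refine (h1.mul ((h.ode t ht).add (h2.mul (h.deriv t ht)))).congr_deriv ?_
  rw [liouville, potential_eq ht.1]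
  simp only [Pi.add_apply, Pi.mul_apply]
  push_cast
  ring

/-- The energy `|u'|² + k² |u|²` of `u = Δ ^ (1 / 2) y` grows at most at the rate
`(|k² - l²| + |V|) / k`. -/
lemma IsRegularSol.energy_le (h : IsRegularSol α β l T y y') {k t₀ t : ℝ} (hk : 0 < k)
    (h0 : 0 < t₀) (h1 : t₀ ≤ t) (h2 : t < T) :
    ‖liouville' α β y y' t‖ ^ 2 + k ^ 2 * ‖liouville α β y t‖ ^ 2 ≤
      (‖liouville' α β y y' t₀‖ ^ 2 + k ^ 2 * ‖liouville α β y t₀‖ ^ 2) *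
        Real.exp ((‖(k : ℂ) ^ 2 - l ^ 2‖ * (t - t₀) + (|α ^ 2 - 1 / 4| + |β ^ 2 - 1 / 4|) *
          (Real.cosh t₀ / Real.sinh t₀ - Real.cosh t / Real.sinh t)) / k) := by
  set B := |α ^ 2 - 1 / 4| + |β ^ 2 - 1 / 4|
  set K := ‖(k : ℂ) ^ 2 - l ^ 2‖
  let E : ℝ → ℝ := fun t => ‖liouville' α β y y' t‖ ^ 2 + k ^ 2 * ‖liouville α β y t‖ ^ 2
  let g : ℝ → ℝ := fun t => -(K * t - B * (Real.cosh t / Real.sinh t)) / k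
  have hE : ∀ s ∈ Icc t₀ t, HasDerivAt E (2 * inner ℝ (liouville' α β y y' s)
      (((potential α β s : ℂ) - l ^ 2) * liouville α β y s) +
        k ^ 2 * (2 * inner ℝ (liouville α β y s) (liouville' α β y y' s))) s := by
    intro s hs
    have hs' : s ∈ Ioo 0 T := ⟨h0.trans_le hs.1, hs.2.trans_lt h2⟩
    exact (h.hasDerivAt_liouville' hs').norm_sq.add
      ((h.hasDerivAt_liouville hs').norm_sq.const_mul (k ^ 2))
  have hg : ∀ s ∈ Icc t₀ t, HasDerivAt g (-(K + B / Real.sinh s ^ 2) / k) s := by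
    intro s hs
    have hs0 := Real.sinh_pos_iff.2 (h0.trans_le hs.1)
    have h3 := (((hasDerivAt_id s).const_mul K).sub (((Real.hasDerivAt_cosh s).div
      (Real.hasDerivAt_sinh s) hs0.ne').const_mul B)).neg.div_const k
    refine h3.congr_deriv ?_
    have := Real.cosh_sq s
    field_simp
    rw [this]
    ring
  have hF : ∀ s ∈ Icc t₀ t, HasDerivAt (fun s => E s * Real.exp (g s)) _ s :=
    fun s hs => (hE s hs).mul (hg s hs).exp
  have hanti : AntitoneOn (fun s => E s * Real.exp (g s)) (Icc t₀ t) := by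
    refine antitoneOn_of_deriv_nonpos (convex_Icc _ _)
      (fun s hs => (hF s hs).continuousAt.continuousWithinAt)
      (fun s hs => (hF s (interior_subset hs)).differentiableAt.differentiableWithinAt) ?_
    intro s hs
    have hs := interior_subset hs
    rw [(hF s hs).deriv]
    have hs0 := h0.trans_le hs.1
    set u := liouville α β y s
    set u' := liouville' α β y y' s
    have e1 : (2 * inner ℝ u' (((potential α β s : ℂ) - l ^ 2) * u) + k ^ 2 * (2 * inner ℝ u u'))
        = 2 * inner ℝ u' (((potential α β s : ℂ) + ((k : ℂ) ^ 2 - l ^ 2)) * u) := by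
      rw [real_inner_comm u' u]
      have : ((potential α β s : ℂ) + ((k : ℂ) ^ 2 - l ^ 2)) * u
          = ((potential α β s : ℂ) - l ^ 2) * u + ((k ^ 2 : ℝ) : ℂ) * u := by push_cast; ring
      rw [this, inner_add_right, ← Complex.real_smul, real_inner_smul_right]
      ring
    have e2 : inner ℝ u' (((potential α β s : ℂ) + ((k : ℂ) ^ 2 - l ^ 2)) * u)
        ≤ ‖u'‖ * ((B / Real.sinh s ^ 2 + K) * ‖u‖) := by
      refine (real_inner_le_norm _ _).trans ?_
      rw [norm_mul]
      gcongr
      refine (norm_add_le _ _).trans ?_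
      gcongr
      rw [Complex.norm_real]
      exact abs_potential_le α β hs0
    have e3 : 2 * (‖u'‖ * (k * ‖u‖)) ≤ E s := by
      have := sq_nonneg (‖u'‖ - k * ‖u‖)
      simp only [E]
      nlinarith
    have e4 : 0 ≤ B / Real.sinh s ^ 2 + K := by positivity
    have e5 : 2 * (‖u'‖ * ((B / Real.sinh s ^ 2 + K) * ‖u‖))
        ≤ E s * ((K + B / Real.sinh s ^ 2) / k) := by
      calc _ = 2 * (‖u'‖ * (k * ‖u‖)) * ((K + B / Real.sinh s ^ 2) / k) := by field_simp; ring
        _ ≤ _ := by gcongr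
    rw [e1]
    have e6 := Real.exp_pos (g s)
    have e7 : 2 * inner ℝ u' (((potential α β s : ℂ) + ((k : ℂ) ^ 2 - l ^ 2)) * u)
        - E s * ((K + B / Real.sinh s ^ 2) / k) ≤ 0 := by linarith
    calc _ = (2 * inner ℝ u' (((potential α β s : ℂ) + ((k : ℂ) ^ 2 - l ^ 2)) * u)
        - E s * ((K + B / Real.sinh s ^ 2) / k)) * Real.exp (g s) := by ring
      _ ≤ 0 := mul_nonpos_of_nonpos_of_nonneg e7 e6.le
  have hfin := hanti (left_mem_Icc.2 h1) (right_mem_Icc.2 h1) h1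
  simp only at hfin
  have hx : (K * (t - t₀) + B * (Real.cosh t₀ / Real.sinh t₀ - Real.cosh t / Real.sinh t)) / k
      = g t₀ - g t := by simp only [g]; ring
  rw [hx, Real.exp_sub, mul_div_assoc', le_div_iff₀ (Real.exp_pos _)]
  exact hfin

lemma sinh_le_mul_cosh {t : ℝ} (ht : 0 ≤ t) : Real.sinh t ≤ t * Real.cosh t := by
  have hm : MonotoneOn (fun t => t * Real.cosh t - Real.sinh t) (Ici 0) := by
    have hd : ∀ s : ℝ, HasDerivAt (fun t => t * Real.cosh t - Real.sinh t)
        (s * Real.sinh s) s := fun s => by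
      refine (((hasDerivAt_id s).mul (Real.hasDerivAt_cosh s)).sub
        (Real.hasDerivAt_sinh s)).congr_deriv ?_
      simp
    refine monotoneOn_of_deriv_nonneg (convex_Ici 0)
      (fun s _ => (hd s).continuousAt.continuousWithinAt)
      (fun s _ => (hd s).differentiableAt.differentiableWithinAt) (fun s hs => ?_)
    rw [(hd s).deriv]
    have hs' : 0 < s := by simpa using hs
    exact mul_nonneg hs'.le (Real.sinh_nonneg_iff.2 hs'.le)
  have := hm (self_mem_Ici (a := (0 : ℝ))) ht ht
  simp at this
  linarith

lemma cosh_le_cosh_one {t : ℝ} (ht : 0 ≤ t) (ht1 : t ≤ 1) : Real.cosh t ≤ Real.cosh 1 := by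
  rw [Real.cosh_le_cosh, abs_of_nonneg ht, abs_one]
  exact ht1

lemma sqrtDelta_le (hα : -(1 / 2) < α) (hβ : -(1 / 2) < β) {t : ℝ} (ht : 0 < t) (ht1 : t ≤ 1) :
    sqrtDelta α β t ≤
      (2 * Real.cosh 1) ^ (α + 1 / 2) * (2 * Real.cosh 1) ^ (β + 1 / 2) * t ^ (α + 1 / 2) := by
  have hc := Real.cosh_pos 1
  have h1 : 2 * Real.sinh t ≤ 2 * Real.cosh 1 * t := by
    have := sinh_le_mul_cosh ht.le
    have := cosh_le_cosh_one ht.le ht1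
    nlinarith
  have h2 := cosh_le_cosh_one ht.le ht1
  have h3 := Real.sinh_pos_iff.2 ht
  have h5 : 0 ≤ α + 1 / 2 := by linarith
  have h6 : 0 ≤ β + 1 / 2 := by linarith
  have h7 := Real.cosh_pos t
  calc sqrtDelta α β t ≤ (2 * Real.cosh 1 * t) ^ (α + 1 / 2) * (2 * Real.cosh 1) ^ (β + 1 / 2) := by
        unfold sqrtDelta; gcongr
    _ = _ := by rw [Real.mul_rpow (by positivity) ht.le]; ring

/-- With `k = |l|` one has `|k² - l²| = 2 |im l| k`, so that the frequency mismatch in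
`IsRegularSol.energy_le` costs exactly `e^(|im l| t)`; the term `e^t` covers `|l| < 1`. -/
lemma exp_norm_sq_sub_sq_le {l : ℂ} {k : ℝ} (hk : k = max 1 ‖l‖) {t : ℝ} (ht : 0 ≤ t) :
    Real.exp (‖(k : ℂ) ^ 2 - l ^ 2‖ * t / k / 2) ≤ Real.exp (|l.im| * t) + Real.exp t := by
  have hk0 : 0 < k := by rw [hk]; positivity
  rcases le_total 1 ‖l‖ with h | h
  · rw [max_eq_right h] at hk
    have h1 : ‖(k : ℂ) ^ 2 - l ^ 2‖ = 2 * |l.im| * k := by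
      have h2 : (k : ℂ) ^ 2 = l * (starRingEnd ℂ) l := by rw [hk, Complex.mul_conj']
      have h3 : (k : ℂ) ^ 2 - l ^ 2 = -(l * (l - (starRingEnd ℂ) l)) := by rw [h2]; ring
      rw [h3, norm_neg, norm_mul, Complex.sub_conj, ← hk]
      simp
      ring
    have h2 : ‖(k : ℂ) ^ 2 - l ^ 2‖ * t / k / 2 = |l.im| * t := by rw [h1]; field_simp
    rw [h2]
    linarith [Real.exp_pos t]
  · rw [max_eq_left h] at hk
    have h1 : ‖(k : ℂ) ^ 2 - l ^ 2‖ ≤ 2 := by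
      refine (norm_sub_le _ _).trans ?_
      rw [hk, norm_pow, norm_pow]
      have : ‖l‖ ^ 2 ≤ 1 := pow_le_one₀ (norm_nonneg _) h
      simp
      linarith
    have h2 : ‖(k : ℂ) ^ 2 - l ^ 2‖ * t / k / 2 ≤ t := by
      rw [div_div, div_le_iff₀ (by positivity)]
      have h3 : t * (k * 2) = 2 * t := by rw [hk]; ring
      rw [h3]
      gcongr
    have := Real.exp_le_exp.2 h2
    linarith [Real.exp_pos (|l.im| * t)]

set_option maxHeartbeats 400000 in
/-- The pointwise bound for regular solutions that is uniform in the spectral parameter. It is the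
only analytic information on Jacobi functions that enters the kernel estimate. The two regimes
`t ≤ ε / k` and `t ≥ ε / k` are treated by `IsRegularSol.norm_le_of_small` and
`IsRegularSol.energy_le`. -/
theorem exists_bound_isRegularSol (hα : -(1 / 2) < α) (hβ : -(1 / 2) < β) :
    ∃ C : ℝ, 0 < C ∧ ∀ (l : ℂ) (T : ℝ) (y y' : ℝ → ℂ), IsRegularSol α β l T y y' →
      ∀ t ∈ Ioo 0 T, ‖y t‖ * sqrtDelta α β t ≤ C * ‖y 0‖ * (max 1 ‖l‖) ^ (-(α + 1 / 2)) *
        (Real.exp (|l.im| * t) + Real.exp t) := by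
  set ρ2 := rho α β ^ 2 with hρ2
  -- `t ≤ e / k` guarantees `|ρ² + l²| t² ≤ 1 / 2`
  set e : ℝ := 1 / (2 * (ρ2 + 1)) with he
  set Cq := (2 * Real.cosh 1) ^ (α + 1 / 2) * (2 * Real.cosh 1) ^ (β + 1 / 2) with hCq
  set D := (α + 1 / 2) * (Real.cosh 1 / e) + (β + 1 / 2) with hD
  set B := |α ^ 2 - 1 / 4| + |β ^ 2 - 1 / 4| with hB
  set C1 := (1 + 2 * D) ^ 2 + 4 with hC1
  set C2 := Real.exp (B * (Real.cosh 1 / e) / 2) with hC2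
  have hρ20 : 0 ≤ ρ2 := sq_nonneg _
  have he0 : 0 < e := by positivity
  have he1 : e ≤ 1 / 2 := by
    rw [he, div_le_div_iff₀ (by positivity) (by norm_num)]; linarith
  have heρ : e * (ρ2 + 1) = 1 / 2 := by rw [he]; field_simp
  have hch := Real.cosh_pos 1
  have hCq0 : 0 < Cq := by positivity
  have ha : 0 < α + 1 / 2 := by linarith
  have hb : 0 < β + 1 / 2 := by linarith
  have hD0 : 0 < D := by positivity
  have hB0 : 0 ≤ B := by positivity
  have hC10 : 1 ≤ C1 := by rw [hC1]; nlinarith [sq_nonneg (1 + 2 * D)]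
  have hC20 : 1 ≤ C2 := Real.one_le_exp (by positivity)
  clear_value Cq C1 C2 D B e ρ2
  refine ⟨Cq * (2 + C1 * C2), by positivity, ?_⟩
  intro l T y y' h t ht
  set k : ℝ := max 1 ‖l‖ with hk
  have hk1 : 1 ≤ k := le_max_left _ _
  have hk0 : 0 < k := by linarith
  have hM : ‖(rho α β : ℂ) ^ 2 + l ^ 2‖ ≤ (ρ2 + 1) * k ^ 2 := by
    have h1 : ‖l‖ ≤ k := le_max_right _ _
    have h2 : ‖(rho α β : ℂ) ^ 2‖ = ρ2 := by rw [norm_pow, Complex.norm_real]; simp [hρ2]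
    refine (norm_add_le _ _).trans ?_
    rw [h2, norm_pow]
    have h3 : ‖l‖ ^ 2 ≤ k ^ 2 := by gcongr
    have h4 : ρ2 ≤ ρ2 * k ^ 2 := le_mul_of_one_le_right hρ20 (one_le_pow₀ hk1)
    linarith
  have hexp1 : 1 ≤ Real.exp (|l.im| * t) + Real.exp t := by
    have := Real.one_le_exp ht.1.le
    linarith [Real.exp_pos (|l.im| * t)]
  clear_value k
  set t₀ := e / k with ht₀
  have ht00 : 0 < t₀ := by positivity
  have ht01 : t₀ ≤ 1 := by
    rw [ht₀, div_le_one hk0]; linarith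
  have hsmall : ∀ s, 0 < s → s ≤ t₀ → ‖(rho α β : ℂ) ^ 2 + l ^ 2‖ * s ^ 2 ≤ 1 / 2 := by
    intro s hs hst
    calc _ ≤ (ρ2 + 1) * k ^ 2 * t₀ ^ 2 := by gcongr
      _ = (e * (ρ2 + 1)) * e := by rw [ht₀]; field_simp
      _ ≤ 1 / 2 := by rw [heρ]; linarith
  have hq0 : sqrtDelta α β t₀ ≤ Cq * k ^ (-(α + 1 / 2)) := by
    refine (sqrtDelta_le hα hβ ht00 ht01).trans ?_
    rw [← hCq]
    rw [Real.rpow_neg hk0.le, ← Real.inv_rpow hk0.le]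
    gcongr
    rw [ht₀, div_eq_mul_inv]
    exact mul_le_of_le_one_left (by positivity) (by linarith)
  have hkpos : 0 < k ^ (-(α + 1 / 2)) := by positivity
  set Ex := Real.exp (|l.im| * t) + Real.exp t with hEx
  clear_value t₀ Ex
  rcases le_total t t₀ with htt | htt
  · have h1 := (h.norm_le_of_small hα hβ ht (hsmall t ht.1 htt)).1
    have h2 := (sqrtDelta_mono hα hβ ht.1 htt).trans hq0
    have h3 := (sqrtDelta_pos (α := α) (β := β) ht.1).le
    calc ‖y t‖ * sqrtDelta α β t ≤ (2 * ‖y 0‖) * (Cq * k ^ (-(α + 1 / 2))) := by gcongr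
      _ = Cq * 2 * ‖y 0‖ * k ^ (-(α + 1 / 2)) * 1 := by ring
      _ ≤ Cq * (2 + C1 * C2) * ‖y 0‖ * k ^ (-(α + 1 / 2)) * Ex := by
        gcongr
        have : 0 ≤ C1 * C2 := by positivity
        linarith
  · have ht0T : t₀ ∈ Ioo 0 T := ⟨ht00, htt.trans_lt ht.2⟩
    obtain ⟨h1, h2⟩ := h.norm_le_of_small hα hβ ht0T (hsmall t₀ ht00 le_rfl)
    have hy' : ‖y' t₀‖ ≤ k * ‖y 0‖ := by
      refine h2.trans ?_
      calc _ ≤ 2 * ((ρ2 + 1) * k ^ 2) * t₀ * ‖y 0‖ := by gcongr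
        _ = 2 * (e * (ρ2 + 1)) * k * ‖y 0‖ := by rw [ht₀]; field_simp
        _ = k * ‖y 0‖ := by rw [heρ]; ring
    have hs0 := Real.sinh_pos_iff.2 ht00
    have hsl : t₀ ≤ Real.sinh t₀ := (Real.self_le_sinh_iff).2 ht00.le
    have hcoth : Real.cosh t₀ / Real.sinh t₀ ≤ Real.cosh 1 / e * k := by
      have := cosh_le_cosh_one ht00.le ht01
      calc _ ≤ Real.cosh 1 / t₀ := by gcongr
        _ = _ := by rw [ht₀]; field_simp
    have hdamp0 : 0 ≤ damping α β t₀ / 2 := by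
      have := Real.cosh_pos t₀
      unfold damping
      have : 0 ≤ 2 * α + 1 := by linarith
      have : 0 ≤ 2 * β + 1 := by linarith
      positivity
    have hdamp : damping α β t₀ / 2 ≤ D * k := by
      have h3 : Real.sinh t₀ / Real.cosh t₀ ≤ 1 := by
        rw [div_le_one (Real.cosh_pos _)]; exact (Real.sinh_lt_cosh _).le
      calc damping α β t₀ / 2 = (α + 1 / 2) * (Real.cosh t₀ / Real.sinh t₀) +
            (β + 1 / 2) * (Real.sinh t₀ / Real.cosh t₀) := by unfold damping; ring
        _ ≤ (α + 1 / 2) * (Real.cosh 1 / e * k) + (β + 1 / 2) * 1 := by gcongr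
        _ ≤ D * k := by
          rw [hD]
          have := le_mul_of_one_le_right hb.le hk1
          linarith
    have hE0 : ‖liouville' α β y y' t₀‖ ^ 2 + k ^ 2 * ‖liouville α β y t₀‖ ^ 2
        ≤ (Cq * k ^ (-(α + 1 / 2)) * k * ‖y 0‖) ^ 2 * C1 := by
      have hqn : ‖(sqrtDelta α β t₀ : ℂ)‖ = sqrtDelta α β t₀ := by
        rw [Complex.norm_of_nonneg (sqrtDelta_pos ht00).le]
      have h3 : ‖liouville' α β y y' t₀‖
          ≤ (Cq * k ^ (-(α + 1 / 2)) * k * ‖y 0‖) * (1 + 2 * D) := by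
        rw [liouville', norm_mul, hqn]
        have h5 : ‖y' t₀ + ((damping α β t₀ / 2 : ℝ) : ℂ) * y t₀‖ ≤ k * ‖y 0‖ * (1 + 2 * D) := by
          refine (norm_add_le _ _).trans ?_
          rw [norm_mul, Complex.norm_of_nonneg hdamp0]
          calc _ ≤ k * ‖y 0‖ + D * k * (2 * ‖y 0‖) := by gcongr
            _ = _ := by ring
        calc _ ≤ (Cq * k ^ (-(α + 1 / 2))) * (k * ‖y 0‖ * (1 + 2 * D)) := by gcongr
          _ = _ := by ring
      have h4 : ‖liouville α β y t₀‖ ≤ (Cq * k ^ (-(α + 1 / 2)) * ‖y 0‖) * 2 := by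
        rw [liouville, norm_mul, hqn]
        calc _ ≤ (Cq * k ^ (-(α + 1 / 2))) * (2 * ‖y 0‖) := by gcongr
          _ = _ := by ring
      calc _ ≤ ((Cq * k ^ (-(α + 1 / 2)) * k * ‖y 0‖) * (1 + 2 * D)) ^ 2
            + k ^ 2 * ((Cq * k ^ (-(α + 1 / 2)) * ‖y 0‖) * 2) ^ 2 := by gcongr
        _ = _ := by rw [hC1]; ring
    have hen := h.energy_le hk0 ht00 htt ht.2
    rw [← hB] at hen
    have hex : Real.exp ((‖(k : ℂ) ^ 2 - l ^ 2‖ * (t - t₀) + B *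
          (Real.cosh t₀ / Real.sinh t₀ - Real.cosh t / Real.sinh t)) / k) ≤ (C2 * Ex) ^ 2 := by
      have h6 : (‖(k : ℂ) ^ 2 - l ^ 2‖ * (t - t₀) + B *
          (Real.cosh t₀ / Real.sinh t₀ - Real.cosh t / Real.sinh t)) / k ≤
          2 * (B * (Real.cosh 1 / e) / 2 + ‖(k : ℂ) ^ 2 - l ^ 2‖ * t / k / 2) := by
        have h7 : 0 ≤ Real.cosh t / Real.sinh t :=
          div_nonneg (Real.cosh_pos _).le (Real.sinh_pos_iff.2 ht.1).le
        have h8 : ‖(k : ℂ) ^ 2 - l ^ 2‖ * (t - t₀) ≤ ‖(k : ℂ) ^ 2 - l ^ 2‖ * t := by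
          gcongr; linarith
        have h9 : B * (Real.cosh t₀ / Real.sinh t₀ - Real.cosh t / Real.sinh t)
            ≤ B * (Real.cosh 1 / e * k) := by gcongr; linarith
        rw [div_le_iff₀ hk0]
        have : 2 * (B * (Real.cosh 1 / e) / 2 + ‖(k : ℂ) ^ 2 - l ^ 2‖ * t / k / 2) * k
            = B * (Real.cosh 1 / e * k) + ‖(k : ℂ) ^ 2 - l ^ 2‖ * t := by field_simp
        linarith
      refine (Real.exp_le_exp.2 h6).trans ?_
      rw [mul_comm 2, Real.exp_mul, Real.exp_add, ← hC2]
      have h10 := exp_norm_sq_sub_sq_le hk ht.1.le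
      rw [← hEx] at h10
      have h11 := Real.exp_pos (‖(k : ℂ) ^ 2 - l ^ 2‖ * t / k / 2)
      rw [Real.rpow_two]
      gcongr
    have hlast : (k * (‖y t‖ * sqrtDelta α β t)) ^ 2
        ≤ (k * (Cq * (C1 * C2) * ‖y 0‖ * k ^ (-(α + 1 / 2)) * Ex)) ^ 2 := by
      calc (k * (‖y t‖ * sqrtDelta α β t)) ^ 2 = k ^ 2 * ‖liouville α β y t‖ ^ 2 := by
            rw [liouville, norm_mul, Complex.norm_of_nonneg (sqrtDelta_pos ht.1).le]; ring
        _ ≤ ‖liouville' α β y y' t‖ ^ 2 + k ^ 2 * ‖liouville α β y t‖ ^ 2 := by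
            linarith [sq_nonneg ‖liouville' α β y y' t‖]
        _ ≤ _ := hen
        _ ≤ ((Cq * k ^ (-(α + 1 / 2)) * k * ‖y 0‖) ^ 2 * C1) * (C2 * Ex) ^ 2 := by gcongr
        _ ≤ ((Cq * k ^ (-(α + 1 / 2)) * k * ‖y 0‖) ^ 2 * C1 ^ 2) * (C2 * Ex) ^ 2 := by
            gcongr
            exact le_self_pow₀ hC10 two_ne_zero
        _ = _ := by ring
    have hfin := le_of_mul_le_mul_left (abs_le_of_sq_le_sq' hlast (by positivity)).2 hk0
    refine hfin.trans ?_
    gcongr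
    linarith

end

section

variable {α β : ℝ} {l : ℂ} {T : ℝ} {y y' z z' : ℝ → ℂ}

lemma IsRegularSol.sub (hy : IsRegularSol α β l T y y') (hz : IsRegularSol α β l T z z') :
    IsRegularSol α β l T (y - z) (y' - z') where
  cont := hy.cont.sub hz.cont
  deriv t ht := (hy.deriv t ht).sub (hz.deriv t ht)
  ode t ht := by
    refine ((hy.ode t ht).sub (hz.ode t ht)).congr_deriv ?_
    simp only [Pi.sub_apply]
    ring
  lim := by
    have := hy.lim.sub hz.lim
    simpa [mul_sub] using this

lemma IsRegularSol.neg_param (hy : IsRegularSol α β (-l) T y y') : IsRegularSol α β l T y y' where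
  cont := hy.cont
  deriv := hy.deriv
  ode t ht := by simpa using hy.ode t ht
  lim := hy.lim

lemma IsRegularSol.eq_of_eq_zero (hα : -(1 / 2) < α) (hβ : -(1 / 2) < β)
    (hy : IsRegularSol α β l T y y') (hz : IsRegularSol α β l T z z') (h0 : y 0 = z 0) {t : ℝ}
    (ht : t ∈ Ioo 0 T) : y t = z t := by
  obtain ⟨C, -, hC⟩ := exists_bound_isRegularSol hα hβ
  have h := hC l T _ _ (hy.sub hz) t ht
  simp only [Pi.sub_apply, h0, sub_self, norm_zero, mul_zero, zero_mul] at h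
  have hq := sqrtDelta_pos (α := α) (β := β) ht.1
  have : ‖y t - z t‖ ≤ 0 := nonpos_of_mul_nonpos_left h hq
  simpa [sub_eq_zero] using this

end

/-! ### Jacobi functions as regular solutions -/

/-- The Jacobi function with complex spectral parameter, in the form given by Pfaff's
transformation. It is the global regular solution with value `1` at `0`. -/
def psi (α β : ℝ) (l : ℂ) (t : ℝ) : ℂ :=
  Complex.exp (-((rho α β : ℂ) - Complex.I * l) * Real.log (Real.cosh t)) *
    hypF (((rho α β : ℂ) - Complex.I * l) / 2) (((α : ℂ) - β + 1 - Complex.I * l) / 2) (α + 1)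
      ((Real.tanh t : ℂ) ^ 2)

/-- The derivative of `psi α β l`. -/
def psi' (α β : ℝ) (l : ℂ) (t : ℝ) : ℂ :=
  Complex.exp (-((rho α β : ℂ) - Complex.I * l) * Real.log (Real.cosh t)) *
    (-((rho α β : ℂ) - Complex.I * l) * Real.tanh t *
      hypF (((rho α β : ℂ) - Complex.I * l) / 2) (((α : ℂ) - β + 1 - Complex.I * l) / 2) (α + 1)
        ((Real.tanh t : ℂ) ^ 2) +
      2 * Real.tanh t * (1 - (Real.tanh t : ℂ) ^ 2) *
        hypF' (((rho α β : ℂ) - Complex.I * l) / 2) (((α : ℂ) - β + 1 - Complex.I * l) / 2) (α + 1)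
          ((Real.tanh t : ℂ) ^ 2))

lemma hasDerivAt_tanh (t : ℝ) : HasDerivAt Real.tanh (1 - Real.tanh t ^ 2) t := by
  have hc := Real.cosh_pos t
  have h := (Real.hasDerivAt_sinh t).div (Real.hasDerivAt_cosh t) hc.ne'
  have he : Real.tanh = fun t => Real.sinh t / Real.cosh t := by
    ext t; exact Real.tanh_eq_sinh_div_cosh t
  rw [he]
  refine h.congr_deriv ?_
  field_simp

lemma norm_tanh_sq_lt_one (t : ℝ) : ‖(Real.tanh t : ℂ) ^ 2‖ < 1 := by
  rw [norm_pow, Complex.norm_real, Real.norm_eq_abs]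
  exact pow_lt_one₀ (abs_nonneg _) (Real.abs_tanh_lt_one t) two_ne_zero

lemma hasDerivAt_tanh_sq (t : ℝ) : HasDerivAt (fun t : ℝ => (Real.tanh t : ℂ) ^ 2)
    (2 * Real.tanh t * (1 - (Real.tanh t : ℂ) ^ 2)) t := by
  refine ((hasDerivAt_tanh t).ofReal_comp.pow 2).congr_deriv ?_
  push_cast
  ring

lemma hasDerivAt_exp_log_cosh (a : ℂ) (t : ℝ) :
    HasDerivAt (fun t : ℝ => Complex.exp (-a * Real.log (Real.cosh t)))
      (Complex.exp (-a * Real.log (Real.cosh t)) * (-a * Real.tanh t)) t := by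
  have h := ((((Real.hasDerivAt_cosh t).log (Real.cosh_pos t).ne').ofReal_comp).const_mul (-a)).cexp
  rw [Real.tanh_eq_sinh_div_cosh]
  exact h

section

variable {α β : ℝ}

lemma hasDerivAt_psi (hα : -1 < α) (l : ℂ) (t : ℝ) :
    HasDerivAt (psi α β l) (psi' α β l t) t := by
  have hc : 0 < α + 1 := by linarith
  have h1 := (hasDerivAt_hypF (((rho α β : ℂ) - Complex.I * l) / 2)
    (((α : ℂ) - β + 1 - Complex.I * l) / 2) hc (norm_tanh_sq_lt_one t)).comp t
    (hasDerivAt_tanh_sq t)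
  refine ((hasDerivAt_exp_log_cosh ((rho α β : ℂ) - Complex.I * l) t).mul h1).congr_deriv ?_
  rw [psi']
  simp only [Function.comp_apply]
  ring

lemma hasDerivAt_psi' (hα : -1 < α) (l : ℂ) (t : ℝ) :
    HasDerivAt (psi' α β l) (Complex.exp (-((rho α β : ℂ) - Complex.I * l) *
      Real.log (Real.cosh t)) *
     ((-((rho α β : ℂ) - Complex.I * l) * Real.tanh t) *
      (-((rho α β : ℂ) - Complex.I * l) * Real.tanh t *
      hypF (((rho α β : ℂ) - Complex.I * l) / 2) (((α : ℂ) - β + 1 - Complex.I * l) / 2) (α + 1)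
        ((Real.tanh t : ℂ) ^ 2) +
      2 * Real.tanh t * (1 - (Real.tanh t : ℂ) ^ 2) *
        hypF' (((rho α β : ℂ) - Complex.I * l) / 2) (((α : ℂ) - β + 1 - Complex.I * l) / 2) (α + 1)
          ((Real.tanh t : ℂ) ^ 2)) +
     (-((rho α β : ℂ) - Complex.I * l) * (1 - (Real.tanh t : ℂ) ^ 2) *
      hypF (((rho α β : ℂ) - Complex.I * l) / 2) (((α : ℂ) - β + 1 - Complex.I * l) / 2) (α + 1)
        ((Real.tanh t : ℂ) ^ 2) +
      (-((rho α β : ℂ) - Complex.I * l) * Real.tanh t *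
          (2 * Real.tanh t * (1 - (Real.tanh t : ℂ) ^ 2))
        + 2 * (1 - (Real.tanh t : ℂ) ^ 2) * (1 - 3 * (Real.tanh t : ℂ) ^ 2)) *
        hypF' (((rho α β : ℂ) - Complex.I * l) / 2) (((α : ℂ) - β + 1 - Complex.I * l) / 2) (α + 1)
          ((Real.tanh t : ℂ) ^ 2) +
      (2 * Real.tanh t * (1 - (Real.tanh t : ℂ) ^ 2)) ^ 2 *
        hypF'' (((rho α β : ℂ) - Complex.I * l) / 2) (((α : ℂ) - β + 1 - Complex.I * l) / 2) (α + 1)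
          ((Real.tanh t : ℂ) ^ 2)))) t := by
  have hc : 0 < α + 1 := by linarith
  have h1 := (hasDerivAt_hypF (((rho α β : ℂ) - Complex.I * l) / 2)
    (((α : ℂ) - β + 1 - Complex.I * l) / 2) hc (norm_tanh_sq_lt_one t)).comp t
    (hasDerivAt_tanh_sq t)
  have h2 := (hasDerivAt_hypF' (((rho α β : ℂ) - Complex.I * l) / 2)
    (((α : ℂ) - β + 1 - Complex.I * l) / 2) hc (norm_tanh_sq_lt_one t)).comp t
    (hasDerivAt_tanh_sq t)
  have h3 := (hasDerivAt_tanh t).ofReal_comp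
  have h4 := hasDerivAt_exp_log_cosh ((rho α β : ℂ) - Complex.I * l) t
  have h5 := h4.mul (((h3.const_mul (-((rho α β : ℂ) - Complex.I * l))).mul h1).add
    (((h3.const_mul 2).mul ((hasDerivAt_tanh_sq t).const_sub 1)).mul h2))
  refine h5.congr_deriv ?_
  simp only [Function.comp_apply, Pi.add_apply, Pi.mul_apply]
  push_cast
  ring

lemma psi_zero (l : ℂ) : psi α β l 0 = 1 := by simp [psi, hypF_zero]

lemma tendsto_Delta_mul {α β : ℝ} (hα : -(1 / 2) < α) {f : ℝ → ℂ} (hf : ContinuousAt f 0) :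
    Tendsto (fun t => (Delta α β t : ℂ) * f t) (𝓝[>] 0) (𝓝 0) := by
  have h1 : ContinuousAt (Delta α β) 0 := by
    unfold Delta
    refine ContinuousAt.mul ?_ ?_
    · exact ContinuousAt.rpow_const (by fun_prop) (Or.inr (by linarith))
    · exact ContinuousAt.rpow_const (by fun_prop) (Or.inl (by simp))
  have h2 : Delta α β 0 = 0 := by
    rw [Delta, Real.sinh_zero, mul_zero, Real.zero_rpow (by linarith), zero_mul]
  have h3 : ContinuousAt (fun t => (Delta α β t : ℂ) * f t) 0 :=
    (Complex.continuous_ofReal.continuousAt.comp h1).mul hf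
  have h4 := h3.tendsto
  simp only [h2, Complex.ofReal_zero, zero_mul] at h4
  exact h4.mono_left nhdsWithin_le_nhds

lemma isRegularSol_psi (hα : -(1 / 2) < α) (l : ℂ) (T : ℝ) :
    IsRegularSol α β l T (psi α β l) (psi' α β l) where
  cont t _ := (hasDerivAt_psi (by linarith) l t).continuousAt.continuousWithinAt
  deriv t _ := hasDerivAt_psi (by linarith) l t
  lim := tendsto_Delta_mul hα (hasDerivAt_psi' (by linarith) l 0).continuousAt
  ode t ht := by
    refine (hasDerivAt_psi' (by linarith) l t).congr_deriv ?_
    have hc : 0 < α + 1 := by linarith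
    have hode := hypF_ode (((rho α β : ℂ) - Complex.I * l) / 2)
      (((α : ℂ) - β + 1 - Complex.I * l) / 2) hc (norm_tanh_sq_lt_one t)
    have hs := Real.sinh_pos_iff.2 ht.1
    have hch := Real.cosh_pos t
    have hd : (damping α β t : ℂ) * (Real.tanh t : ℂ)
        = 2 * α + 1 + (2 * β + 1) * (Real.tanh t : ℂ) ^ 2 := by
      rw [Real.tanh_eq_sinh_div_cosh, damping]
      have h1 : (Real.sinh t : ℂ) ≠ 0 := by exact_mod_cast hs.ne'
      have h2 : (Real.cosh t : ℂ) ≠ 0 := by exact_mod_cast hch.ne'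
      push_cast at h1 h2 ⊢
      field_simp
    rw [psi', psi]
    set P := Complex.exp (-((rho α β : ℂ) - Complex.I * l) * Real.log (Real.cosh t))
    set F := hypF (((rho α β : ℂ) - Complex.I * l) / 2) (((α : ℂ) - β + 1 - Complex.I * l) / 2)
      (α + 1) ((Real.tanh t : ℂ) ^ 2)
    set F1 := hypF' (((rho α β : ℂ) - Complex.I * l) / 2) (((α : ℂ) - β + 1 - Complex.I * l) / 2)
      (α + 1) ((Real.tanh t : ℂ) ^ 2)
    set F2 := hypF'' (((rho α β : ℂ) - Complex.I * l) / 2) (((α : ℂ) - β + 1 - Complex.I * l) / 2)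
      (α + 1) ((Real.tanh t : ℂ) ^ 2)
    set τ := (Real.tanh t : ℂ)
    have hI : Complex.I ^ 2 = -1 := Complex.I_sq
    have hρ : (rho α β : ℂ) = α + β + 1 := by simp [rho]
    rw [hρ] at hode ⊢
    push_cast at hode
    linear_combination (4 * (1 - τ ^ 2) * P) * hode + (l ^ 2 * P * F) * hI
      + P * (-((α : ℂ) + β + 1 - Complex.I * l) * F + 2 * (1 - τ ^ 2) * F1) * hd

/-- The hypergeometric series at `-sinh² t` is a regular solution as long as `sinh t < 1`. -/
lemma isRegularSol_hypF (hα : -(1 / 2) < α) (l : ℂ) :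
    IsRegularSol α β l (Real.arsinh 1)
      (fun t => hypF (((rho α β : ℂ) - Complex.I * l) / 2) (((rho α β : ℂ) + Complex.I * l) / 2)
        (α + 1) (-(Real.sinh t : ℂ) ^ 2))
      (fun t => -(2 * Real.sinh t * Real.cosh t) *
        hypF' (((rho α β : ℂ) - Complex.I * l) / 2) (((rho α β : ℂ) + Complex.I * l) / 2)
        (α + 1) (-(Real.sinh t : ℂ) ^ 2)) := by
  have hc : 0 < α + 1 := by linarith
  have hlt : ∀ t ∈ Ico 0 (Real.arsinh 1), ‖-(Real.sinh t : ℂ) ^ 2‖ < 1 := by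
    intro t ht
    have h1 : Real.sinh t < 1 := by
      have := Real.sinh_lt_sinh.2 ht.2
      rwa [Real.sinh_arsinh] at this
    have h0 : 0 ≤ Real.sinh t := Real.sinh_nonneg_iff.2 ht.1
    rw [norm_neg, norm_pow, Complex.norm_of_nonneg h0]
    exact pow_lt_one₀ h0 h1 two_ne_zero
  have hz : ∀ t : ℝ, HasDerivAt (fun t : ℝ => -(Real.sinh t : ℂ) ^ 2)
      (-(2 * Real.sinh t * Real.cosh t)) t := by
    intro t
    refine ((Real.hasDerivAt_sinh t).ofReal_comp.pow 2).neg.congr_deriv ?_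
    push_cast
    ring
  set a := ((rho α β : ℂ) - Complex.I * l) / 2 with ha
  set b := ((rho α β : ℂ) + Complex.I * l) / 2 with hb
  have h1 : ∀ t ∈ Ico 0 (Real.arsinh 1), HasDerivAt
      (fun t : ℝ => hypF a b (α + 1) (-(Real.sinh t : ℂ) ^ 2))
      (-(2 * Real.sinh t * Real.cosh t) * hypF' a b (α + 1) (-(Real.sinh t : ℂ) ^ 2)) t := by
    intro t ht
    refine ((hasDerivAt_hypF a b hc (hlt t ht)).comp t (hz t)).congr_deriv ?_
    ring
  have h2 : ∀ t ∈ Ico 0 (Real.arsinh 1), HasDerivAt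
      (fun t : ℝ => -(2 * Real.sinh t * Real.cosh t) * hypF' a b (α + 1) (-(Real.sinh t : ℂ) ^ 2))
      (-2 * (Real.cosh t ^ 2 + Real.sinh t ^ 2) * hypF' a b (α + 1) (-(Real.sinh t : ℂ) ^ 2) +
        (2 * Real.sinh t * Real.cosh t) ^ 2 * hypF'' a b (α + 1) (-(Real.sinh t : ℂ) ^ 2)) t := by
    intro t ht
    refine (((((Real.hasDerivAt_sinh t).ofReal_comp.const_mul (2 : ℂ)).mul
      (Real.hasDerivAt_cosh t).ofReal_comp).neg).mul
      ((hasDerivAt_hypF' a b hc (hlt t ht)).comp t (hz t))).congr_deriv ?_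
    simp only [Function.comp_apply, Pi.neg_apply, Pi.mul_apply]
    ring
  have h0 : (0 : ℝ) ∈ Ico 0 (Real.arsinh 1) := ⟨le_rfl, Real.arsinh_pos_iff.2 one_pos⟩
  refine ⟨fun t ht => (h1 t ht).continuousAt.continuousWithinAt,
    fun t ht => h1 t ⟨ht.1.le, ht.2⟩, fun t ht => ?_, tendsto_Delta_mul hα (h2 0 h0).continuousAt⟩
  have ht' : t ∈ Ico 0 (Real.arsinh 1) := ⟨ht.1.le, ht.2⟩
  refine (h2 t ht').congr_deriv ?_
  have hode := hypF_ode a b hc (hlt t ht')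
  have hs := Real.sinh_pos_iff.2 ht.1
  have hch := Real.cosh_pos t
  have e1 : (Real.sinh t : ℂ) ≠ 0 := by exact_mod_cast hs.ne'
  have e2 : (Real.cosh t : ℂ) ≠ 0 := by exact_mod_cast hch.ne'
  have e3 : (Real.cosh t : ℂ) ^ 2 = (Real.sinh t : ℂ) ^ 2 + 1 := by exact_mod_cast Real.cosh_sq t
  have hd : (damping α β t : ℂ) * (-(2 * Real.sinh t * Real.cosh t))
      = -2 * ((2 * α + 1) * (Real.cosh t : ℂ) ^ 2 + (2 * β + 1) * (Real.sinh t : ℂ) ^ 2) := by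
    rw [damping]
    simp only [Complex.ofReal_add, Complex.ofReal_mul, Complex.ofReal_div, Complex.ofReal_ofNat,
      Complex.ofReal_one]
    field_simp
  generalize hypF a b (α + 1) (-(Real.sinh t : ℂ) ^ 2) = F at *
  generalize hypF' a b (α + 1) (-(Real.sinh t : ℂ) ^ 2) = F1 at *
  generalize hypF'' a b (α + 1) (-(Real.sinh t : ℂ) ^ 2) = F2 at *
  have hI : Complex.I ^ 2 = -1 := Complex.I_sq
  have hρ : (rho α β : ℂ) = α + β + 1 := by simp [rho]
  rw [ha, hb, hρ] at hode
  rw [hρ]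
  simp only [Complex.ofReal_add, Complex.ofReal_one] at hode
  generalize (Real.sinh t : ℂ) = S at *
  generalize (Real.cosh t : ℂ) = C at *
  have e4 : (2 * S * C) ^ 2 = 4 * S ^ 2 * (S ^ 2 + 1) := by rw [← e3]; ring
  rw [e4, e3]
  rw [e3] at hd
  linear_combination (-4) * hode + (l ^ 2 * F) * hI + F1 * hd

end

/-! ### Symmetry and difference equation in the spectral variable -/

section

variable {α β : ℝ}

/-- `psi α β l` and `psi α β (-l)` solve the same equation, so they agree by uniqueness. -/
lemma psi_neg (hα : -(1 / 2) < α) (hβ : -(1 / 2) < β) (l : ℂ) {t : ℝ} (ht : 0 < t) :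
    psi α β (-l) t = psi α β l t :=
  (isRegularSol_psi hα (-l) (t + 1)).neg_param.eq_of_eq_zero hα hβ (isRegularSol_psi hα l (t + 1))
    (by simp [psi_zero]) ⟨ht, by linarith⟩

/-- Both branches of the definition of `jacobiPhi` agree with `psi`: the second one literally, the
first one by uniqueness of regular solutions. -/
lemma jacobiPhi_eq_psi (hα : -(1 / 2) < α) (hβ : -(1 / 2) < β) (l : ℝ) {t : ℝ} (ht : 0 < t) :
    jacobiPhi α β l t = psi α β l t := by
  have hs := Real.sinh_pos_iff.2 ht
  have hch := Real.cosh_pos t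
  have hc1 : ((α : ℂ) + 1) = ((α + 1 : ℝ) : ℂ) := by push_cast; rfl
  rw [jacobiPhi, gaussHyp]
  split_ifs with h
  · have ht' : t < Real.arsinh 1 := by
      rw [norm_neg, Complex.norm_of_nonneg (sq_nonneg _), sq_lt_one_iff₀ hs.le] at h
      rw [← Real.sinh_lt_sinh, Real.sinh_arsinh]
      exact h
    rw [hc1, ordinaryHypergeometric_eq_hypF]
    have := (isRegularSol_hypF hα (l : ℂ)).eq_of_eq_zero hα hβ
      (isRegularSol_psi hα l (Real.arsinh 1)) (by simp [psi_zero, hypF_zero]) ⟨ht, ht'⟩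
    rw [← this]
    push_cast
    rfl
  · have h1 : (1 : ℂ) - -((Real.sinh t ^ 2 : ℝ) : ℂ) = ((Real.cosh t ^ 2 : ℝ) : ℂ) := by
      rw [Real.cosh_sq]; push_cast; ring
    have h2 : (-((Real.sinh t ^ 2 : ℝ) : ℂ)) / (-((Real.sinh t ^ 2 : ℝ) : ℂ) - 1)
        = (Real.tanh t : ℂ) ^ 2 := by
      have : -((Real.sinh t ^ 2 : ℝ) : ℂ) - 1 = -((Real.cosh t ^ 2 : ℝ) : ℂ) := by
        rw [← h1]; ring
      rw [this, neg_div_neg_eq, Real.tanh_eq_sinh_div_cosh]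
      push_cast
      rw [div_pow]
    have h3 : (((Real.cosh t ^ 2 : ℝ)) : ℂ) ≠ 0 := by exact_mod_cast (pow_pos hch 2).ne'
    rw [h1, h2, hc1, ordinaryHypergeometric_eq_hypF, psi, Complex.cpow_def_of_ne_zero h3,
      ← Complex.ofReal_log (by positivity), Real.log_pow]
    have h4 : ((α + 1 : ℝ) : ℂ) - ((rho α β : ℂ) + Complex.I * l) / 2
        = ((α : ℂ) - β + 1 - Complex.I * l) / 2 := by
      simp only [rho]; push_cast; ring
    rw [h4]
    congr 2
    push_cast
    ring

lemma differentiable_psi (hα : -1 < α) (t : ℝ) : Differentiable ℂ fun l => psi α β l t := by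
  unfold psi
  have hc : 0 < α + 1 := by linarith
  refine Differentiable.mul (by fun_prop) ?_
  exact differentiable_hypF hc (by fun_prop) (by fun_prop) (norm_tanh_sq_lt_one t)

lemma continuous_tanh : Continuous Real.tanh :=
  continuous_iff_continuousAt.2 fun t => (hasDerivAt_tanh t).continuousAt

lemma continuous_psi (hα : -1 < α) : Continuous fun p : ℂ × ℝ => psi α β p.1 p.2 := by
  unfold psi
  have hc : 0 < α + 1 := by linarith
  refine Continuous.mul ?_ ?_
  · have h : Continuous fun p : ℂ × ℝ => Real.log (Real.cosh p.2) :=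
      (Real.continuous_cosh.comp continuous_snd).log fun p => (Real.cosh_pos _).ne'
    fun_prop
  · refine continuous_iff_continuousAt.2 fun p => ?_
    have h := continuousAt_hypF hc (((rho α β : ℂ) - Complex.I * p.1) / 2,
      ((α : ℂ) - β + 1 - Complex.I * p.1) / 2, (Real.tanh p.2 : ℂ) ^ 2) (norm_tanh_sq_lt_one p.2)
    have hf : Continuous fun p : ℂ × ℝ => (((rho α β : ℂ) - Complex.I * p.1) / 2,
        ((α : ℂ) - β + 1 - Complex.I * p.1) / 2, (Real.tanh p.2 : ℂ) ^ 2) := by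
      have : Continuous fun p : ℂ × ℝ => Real.tanh p.2 := continuous_tanh.comp continuous_snd
      fun_prop
    exact ContinuousAt.comp (f := fun p : ℂ × ℝ => (((rho α β : ℂ) - Complex.I * p.1) / 2,
        ((α : ℂ) - β + 1 - Complex.I * p.1) / 2, (Real.tanh p.2 : ℂ) ^ 2)) h hf.continuousAt

/-- The coefficient of the difference equation of the Jacobi functions in the spectral variable. -/
def diffCoeff (α β : ℝ) (l : ℂ) : ℂ :=
  ((rho α β : ℂ) - Complex.I * l) / 2 * (((α : ℂ) - β + 1 - Complex.I * l) / 2) /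
    (Complex.I * l * (Complex.I * l - 1))

/-- The second-order difference equation in the spectral variable `l` (bispectrality). Its
eigenvalue `sinh² t` separates the two space variables of the kernel. -/
lemma psi_difference_equation (hα : -1 < α) {l : ℂ} (h0 : Complex.I * l ≠ 0)
    (h1 : Complex.I * l - 1 ≠ 0) (h2 : Complex.I * l + 1 ≠ 0) (t : ℝ) :
    diffCoeff α β l * (psi α β (l + 2 * Complex.I) t - psi α β l t) +
      diffCoeff α β (-l) * (psi α β (l - 2 * Complex.I) t - psi α β l t)
      = (Real.sinh t : ℂ) ^ 2 * psi α β l t := by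
  have hc : 0 < α + 1 := by linarith
  have hch := Real.cosh_pos t
  have key := hypF_contiguous (((rho α β : ℂ) - Complex.I * l) / 2)
    (((α : ℂ) - β + 1 - Complex.I * l) / 2) hc (norm_tanh_sq_lt_one t) (s := Complex.I * l)
    (by simp only [rho]; push_cast; ring) h0 h1 h2
  have hI : Complex.I * Complex.I = -1 := Complex.I_mul_I
  have e1 : ((rho α β : ℂ) - Complex.I * (l + 2 * Complex.I)) / 2
      = ((rho α β : ℂ) - Complex.I * l) / 2 + 1 := by linear_combination (-1 : ℂ) * hI
  have e2 : ((α : ℂ) - β + 1 - Complex.I * (l + 2 * Complex.I)) / 2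
      = ((α : ℂ) - β + 1 - Complex.I * l) / 2 + 1 := by linear_combination (-1 : ℂ) * hI
  have e3 : ((rho α β : ℂ) - Complex.I * (l - 2 * Complex.I)) / 2
      = ((rho α β : ℂ) - Complex.I * l) / 2 - 1 := by linear_combination (1 : ℂ) * hI
  have e4 : ((α : ℂ) - β + 1 - Complex.I * (l - 2 * Complex.I)) / 2
      = ((α : ℂ) - β + 1 - Complex.I * l) / 2 - 1 := by linear_combination (1 : ℂ) * hI
  have hC : (Real.cosh t : ℂ) ≠ 0 := by exact_mod_cast hch.ne'
  have hlog : Complex.exp (Real.log (Real.cosh t)) = Real.cosh t := by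
    rw [← Complex.ofReal_exp, Real.exp_log hch]
  have x1 : Complex.exp (-((rho α β : ℂ) - Complex.I * (l + 2 * Complex.I)) *
      Real.log (Real.cosh t)) = Complex.exp (-((rho α β : ℂ) - Complex.I * l) *
      Real.log (Real.cosh t)) / (Real.cosh t : ℂ) ^ 2 := by
    rw [eq_div_iff (pow_ne_zero 2 hC), ← hlog, ← Complex.exp_nat_mul, ← Complex.exp_add]
    congr 1
    push_cast
    linear_combination (2 * Real.log (Real.cosh t) : ℂ) * hI
  have x2 : Complex.exp (-((rho α β : ℂ) - Complex.I * (l - 2 * Complex.I)) *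
      Real.log (Real.cosh t)) = Complex.exp (-((rho α β : ℂ) - Complex.I * l) *
      Real.log (Real.cosh t)) * (Real.cosh t : ℂ) ^ 2 := by
    rw [← hlog, ← Complex.exp_nat_mul, ← Complex.exp_add]
    congr 1
    push_cast
    linear_combination (-2 * Real.log (Real.cosh t) : ℂ) * hI
  have hT : (Real.tanh t : ℂ) ^ 2 = 1 - 1 / (Real.cosh t : ℂ) ^ 2 := by
    have h := Real.cosh_sq t
    have h' : (Real.cosh t : ℂ) ^ 2 = (Real.sinh t : ℂ) ^ 2 + 1 := by exact_mod_cast h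
    rw [Real.tanh_eq_sinh_div_cosh, Complex.ofReal_div, div_pow, eq_sub_iff_add_eq, ← add_div,
      ← h', div_self (pow_ne_zero 2 hC)]
  have hS : (Real.sinh t : ℂ) ^ 2 = (Real.cosh t : ℂ) ^ 2 - 1 := by
    have h' : (Real.cosh t : ℂ) ^ 2 = (Real.sinh t : ℂ) ^ 2 + 1 := by
      exact_mod_cast Real.cosh_sq t
    rw [h']; ring
  have hB : diffCoeff α β (-l) = (((α + 1 : ℝ) : ℂ) - ((α : ℂ) - β + 1 - Complex.I * l) / 2) *
      (((α + 1 : ℝ) : ℂ) - ((rho α β : ℂ) - Complex.I * l) / 2) /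
        (Complex.I * l * (Complex.I * l + 1)) := by
    unfold diffCoeff
    congr 1
    · simp only [rho]; push_cast; ring
    · ring
  have hA : diffCoeff α β l = ((rho α β : ℂ) - Complex.I * l) / 2 *
      (((α : ℂ) - β + 1 - Complex.I * l) / 2) / (Complex.I * l * (Complex.I * l - 1)) := rfl
  rw [← hA, ← hB] at key
  unfold psi
  rw [e1, e2, e3, e4, x1, x2, hS]
  rw [hT] at key ⊢
  clear hlog x1 x2 hT hS
  generalize diffCoeff α β l = A at *
  generalize diffCoeff α β (-l) = B at *
  generalize hypF _ _ _ _ = F0 at *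
  generalize hypF _ _ _ _ = F1 at *
  generalize hypF _ _ _ _ = F2 at *
  generalize Complex.exp _ = P at *
  generalize (Real.cosh t : ℂ) = C at *
  field_simp at key ⊢
  linear_combination P * key

lemma exists_bound_psi (hα : -(1 / 2) < α) (hβ : -(1 / 2) < β) :
    ∃ C : ℝ, 0 < C ∧ ∀ (l : ℂ) (t : ℝ), 0 < t → ‖psi α β l t‖ ≤
      C * (max 1 ‖l‖) ^ (-(α + 1 / 2)) * (Real.exp (|l.im| * t) + Real.exp t) /
        sqrtDelta α β t := by
  obtain ⟨C, hC0, hC⟩ := exists_bound_isRegularSol hα hβ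
  refine ⟨C, hC0, fun l t ht => ?_⟩
  rw [le_div_iff₀ (sqrtDelta_pos ht)]
  have h := hC l (t + 1) _ _ (isRegularSol_psi hα l (t + 1)) t ⟨ht, by linarith⟩
  simpa [psi_zero] using h

end

/-! ### Quotients of Gamma functions -/

/-- The weighted inequality between the arithmetic and the geometric mean gives
`|w| ^ (2 - 2δ) |w + 1| ^ (2δ) ≤ (1 - δ) |w|² + δ |w + 1|² = |w + δ|² + δ - δ²`; the last two terms
cost only a factor `1 + O(|w|⁻²)`. -/
lemma norm_div_norm_add_le {w : ℂ} (hw : 0 ≤ w.re) (hw1 : 1 ≤ ‖w‖) {δ : ℝ} (h0 : 0 ≤ δ)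
    (h1 : δ ≤ 1) :
    ‖w‖ / ‖w + δ‖ ≤ (‖w‖ / ‖w + 1‖) ^ δ * Real.exp (1 / (8 * ‖w‖ ^ 2)) := by
  have hn : ∀ r : ℝ, ‖w + r‖ ^ 2 = ‖w‖ ^ 2 + 2 * r * w.re + r ^ 2 := by
    intro r
    rw [← Complex.normSq_eq_norm_sq, ← Complex.normSq_eq_norm_sq, Complex.normSq_apply,
      Complex.normSq_apply]
    simp
    ring
  have hw0 : 0 < ‖w‖ := by linarith
  have hle : ‖w‖ ^ 2 ≤ ‖w + δ‖ ^ 2 := by rw [hn]; nlinarith [mul_nonneg h0 hw]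
  have hδ0 : 0 < ‖w + δ‖ := by
    have : 0 < ‖w + δ‖ ^ 2 := lt_of_lt_of_le (by positivity) hle
    exact norm_pos_iff.2 (by rintro h; simp [h] at this)
  have h10 : 0 < ‖w + 1‖ := by
    have h2 := hn 1
    simp only [Complex.ofReal_one] at h2
    have : 0 < ‖w + 1‖ ^ 2 := by rw [h2]; positivity
    exact norm_pos_iff.2 (by rintro h; simp [h] at this)
  have hgm := Real.geom_mean_le_arith_mean2_weighted (w₁ := 1 - δ) (w₂ := δ) (by linarith) h0
    (sq_nonneg ‖w‖) (sq_nonneg ‖w + 1‖) (by ring)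
  have e1 := hn 1
  have e2 := hn δ
  simp only [Complex.ofReal_one] at e1
  have h4 : (1 - δ) * ‖w‖ ^ 2 + δ * ‖w + 1‖ ^ 2 ≤ ‖w + δ‖ ^ 2 * (1 + 1 / (4 * ‖w‖ ^ 2)) := by
    have h5 : 1 / 4 ≤ ‖w + δ‖ ^ 2 * (1 / (4 * ‖w‖ ^ 2)) := by
      rw [mul_one_div, div_le_div_iff₀ (by norm_num) (by positivity)]
      linarith
    nlinarith [sq_nonneg (δ - 1 / 2)]
  have h6 : 1 + 1 / (4 * ‖w‖ ^ 2) ≤ Real.exp (1 / (8 * ‖w‖ ^ 2)) ^ 2 := by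
    rw [← Real.exp_nat_mul]
    refine (add_comm _ _).trans_le ((Real.add_one_le_exp _).trans (Real.exp_le_exp.2 (le_of_eq ?_)))
    push_cast
    field_simp
    norm_num
  have h7 : ‖w‖ ^ (1 - δ) * ‖w + 1‖ ^ δ ≤ ‖w + δ‖ * Real.exp (1 / (8 * ‖w‖ ^ 2)) := by
    refine (abs_le_of_sq_le_sq' ?_ (by positivity)).2
    calc (‖w‖ ^ (1 - δ) * ‖w + 1‖ ^ δ) ^ 2 = (‖w‖ ^ 2) ^ (1 - δ) * (‖w + 1‖ ^ 2) ^ δ := by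
          rw [mul_pow, ← Real.rpow_natCast, ← Real.rpow_natCast, ← Real.rpow_natCast,
            ← Real.rpow_natCast, ← Real.rpow_mul hw0.le, ← Real.rpow_mul h10.le,
            ← Real.rpow_mul hw0.le, ← Real.rpow_mul h10.le, mul_comm (1 - δ), mul_comm δ]
      _ ≤ _ := hgm
      _ ≤ _ := h4
      _ ≤ ‖w + δ‖ ^ 2 * Real.exp (1 / (8 * ‖w‖ ^ 2)) ^ 2 := by gcongr
      _ = _ := by ring
  rw [div_le_iff₀ hδ0, Real.div_rpow hw0.le h10.le, mul_assoc, mul_comm (Real.exp _),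
    div_mul_eq_mul_div, le_div_iff₀ (by positivity)]
  have h8 : ‖w‖ = ‖w‖ ^ δ * ‖w‖ ^ (1 - δ) := by
    rw [← Real.rpow_add hw0]; simp
  calc ‖w‖ * ‖w + 1‖ ^ δ = ‖w‖ ^ δ * (‖w‖ ^ (1 - δ) * ‖w + 1‖ ^ δ) := by
        rw [← mul_assoc, ← h8]
    _ ≤ _ := by gcongr

lemma prod_norm_div_norm_add_le {z : ℂ} (hz : 0 ≤ z.re) {δ : ℝ} (h0 : 0 ≤ δ) (h1 : δ ≤ 1) (n : ℕ) :
    ∏ j ∈ Finset.range n, (‖z + (j + 1 : ℕ)‖ / ‖z + (j + 1 : ℕ) + δ‖) ≤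
      (‖z + 1‖ / ‖z + (n + 1 : ℕ)‖) ^ δ * Real.exp (1 - 1 / (n + 1)) := by
  have hge : ∀ j : ℕ, (j : ℝ) + 1 ≤ ‖z + (j + 1 : ℕ)‖ := by
    intro j
    refine le_trans ?_ (Complex.re_le_norm _)
    simp
    linarith
  induction n with
  | zero =>
    have h := hge 0
    have : 0 < ‖z + 1‖ := by simp at h; linarith
    simp [this.ne']
  | succ n ih =>
    have hn0 : (0 : ℝ) ≤ n := Nat.cast_nonneg n
    have hg := hge n
    have hg1 := hge (n + 1)
    have hg0 := hge 0
    simp only [Nat.cast_zero, zero_add, Nat.cast_one] at hg0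
    have hstep := norm_div_norm_add_le (w := z + (n + 1 : ℕ)) (by simp; linarith)
      (by linarith) h0 h1
    have hw1 : z + (n + 1 : ℕ) + 1 = z + (n + 1 + 1 : ℕ) := by push_cast; ring
    rw [hw1] at hstep
    rw [Finset.prod_range_succ]
    have hp1 : 0 < ‖z + (n + 1 : ℕ)‖ := by linarith
    have hp2 : 0 < ‖z + (n + 1 + 1 : ℕ)‖ := by push_cast at hg1 ⊢; linarith
    calc _ ≤ ((‖z + 1‖ / ‖z + (n + 1 : ℕ)‖) ^ δ * Real.exp (1 - 1 / (n + 1))) *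
          ((‖z + (n + 1 : ℕ)‖ / ‖z + (n + 1 + 1 : ℕ)‖) ^ δ *
            Real.exp (1 / (8 * ‖z + (n + 1 : ℕ)‖ ^ 2))) := by gcongr
      _ = ((‖z + 1‖ / ‖z + (n + 1 : ℕ)‖) * (‖z + (n + 1 : ℕ)‖ / ‖z + (n + 1 + 1 : ℕ)‖)) ^ δ *
          Real.exp (1 - 1 / (n + 1) + 1 / (8 * ‖z + (n + 1 : ℕ)‖ ^ 2)) := by
        rw [Real.mul_rpow (by positivity) (by positivity), Real.exp_add]; ring
      _ = (‖z + 1‖ / ‖z + (n + 1 + 1 : ℕ)‖) ^ δ *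
          Real.exp (1 - 1 / (n + 1) + 1 / (8 * ‖z + (n + 1 : ℕ)‖ ^ 2)) := by
        rw [div_mul_div_cancel₀ hp1.ne']
      _ ≤ _ := by
        gcongr
        have h3 : 1 / (8 * ‖z + (n + 1 : ℕ)‖ ^ 2) ≤ 1 / (8 * ((n : ℝ) + 1) ^ 2) := by gcongr
        have h4 : 1 / (8 * ((n : ℝ) + 1) ^ 2) ≤ 1 / (n + 1) - 1 / (n + 1 + 1) := by
          rw [div_sub_div _ _ (by positivity) (by positivity),
            div_le_div_iff₀ (by positivity) (by positivity)]
          nlinarith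
        push_cast at h3 h4 ⊢
        linarith

/-- Comparison of the partial products in Euler's limit formula. -/
lemma norm_Gamma_add_le_of_le_one {z : ℂ} (hz : 0 ≤ z.re) (hz0 : z ≠ 0) {δ : ℝ} (h0 : 0 ≤ δ)
    (h1 : δ ≤ 1) :
    ‖Complex.Gamma (z + δ)‖ ≤ Real.exp 1 * (1 + ‖z‖) ^ δ * ‖Complex.Gamma z‖ := by
  refine le_of_tendsto_of_tendsto (Complex.GammaSeq_tendsto_Gamma (z + δ)).norm
    ((Complex.GammaSeq_tendsto_Gamma z).norm.const_mul _) ?_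
  filter_upwards [eventually_ge_atTop 1] with n hn
  have hn' : (0 : ℝ) < n := by exact_mod_cast hn
  have hp := prod_norm_div_norm_add_le hz h0 h1 n
  have hj : ∀ j : ℕ, 0 < ‖z + j‖ := by
    intro j
    rcases Nat.eq_zero_or_pos j with rfl | hj
    · simpa using hz0
    · have h2 : 0 < (z + j).re := by
        have : (0 : ℝ) < j := by exact_mod_cast hj
        simp; linarith
      exact h2.trans_le (Complex.re_le_norm _)
  have hjδ : ∀ j : ℕ, ‖z + j‖ ≤ ‖z + δ + j‖ := by
    intro j
    refine (abs_le_of_sq_le_sq' ?_ (norm_nonneg _)).2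
    rw [← Complex.normSq_eq_norm_sq, ← Complex.normSq_eq_norm_sq, Complex.normSq_apply,
      Complex.normSq_apply]
    have : (0 : ℝ) ≤ j := Nat.cast_nonneg j
    simp
    nlinarith
  have hratio : ∏ j ∈ Finset.range (n + 1), (‖z + j‖ / ‖z + δ + j‖) ≤
      ((1 + ‖z‖) / n) ^ δ * Real.exp 1 := by
    rw [Finset.prod_range_succ']
    have h3 : ‖z + (0 : ℕ)‖ / ‖z + δ + (0 : ℕ)‖ ≤ 1 := by
      rw [div_le_one ((hj 0).trans_le (hjδ 0))]; exact hjδ 0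
    have h4 : ∏ j ∈ Finset.range n, (‖z + (j + 1 : ℕ)‖ / ‖z + δ + (j + 1 : ℕ)‖) =
        ∏ j ∈ Finset.range n, (‖z + (j + 1 : ℕ)‖ / ‖z + (j + 1 : ℕ) + δ‖) :=
      Finset.prod_congr rfl fun j _ => by rw [add_right_comm]
    rw [h4]
    refine (mul_le_of_le_one_right (Finset.prod_nonneg fun _ _ => by positivity) h3).trans
      (hp.trans ?_)
    have h5 : ‖z + 1‖ ≤ 1 + ‖z‖ := by
      rw [add_comm]; exact (norm_add_le _ _).trans (by simp)
    have h6 : (n : ℝ) ≤ ‖z + (n + 1 : ℕ)‖ := by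
      refine le_trans ?_ (Complex.re_le_norm _)
      simp
      linarith
    have h7 : (0 : ℝ) ≤ 1 / (n + 1) := by positivity
    gcongr
    linarith
  have hprod : ∀ w : ℂ, ‖Complex.GammaSeq w n‖ =
      (n : ℝ) ^ w.re * n.factorial / ∏ j ∈ Finset.range (n + 1), ‖w + j‖ := by
    intro w
    rw [Complex.GammaSeq, norm_div, norm_mul, norm_prod, Complex.norm_natCast]
    congr 2
    have := Complex.norm_cpow_eq_rpow_re_of_pos hn' w
    simpa using this
  have hP : 0 < ∏ j ∈ Finset.range (n + 1), ‖z + j‖ := Finset.prod_pos fun j _ => hj j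
  rw [hprod, hprod]
  rw [Finset.prod_div_distrib] at hratio
  have e1 : (z + δ).re = z.re + δ := by simp
  rw [e1, Real.rpow_add hn']
  have e2 : (n : ℝ) ^ δ * ((1 + ‖z‖) / n) ^ δ = (1 + ‖z‖) ^ δ := by
    rw [← Real.mul_rpow hn'.le (by positivity)]
    congr 1
    field_simp
  set P := ∏ j ∈ Finset.range (n + 1), ‖z + j‖
  set Q := ∏ j ∈ Finset.range (n + 1), ‖z + δ + j‖
  calc (n : ℝ) ^ z.re * (n : ℝ) ^ δ * n.factorial / Q
      = (n : ℝ) ^ z.re * (n : ℝ) ^ δ * n.factorial / P * (P / Q) := by field_simp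
    _ ≤ (n : ℝ) ^ z.re * (n : ℝ) ^ δ * n.factorial / P * (((1 + ‖z‖) / n) ^ δ * Real.exp 1) := by
      gcongr
    _ = Real.exp 1 * ((n : ℝ) ^ δ * ((1 + ‖z‖) / n) ^ δ) * ((n : ℝ) ^ z.re * n.factorial / P) := by
      ring
    _ = _ := by rw [e2]

/-- `Γ(z + δ) / Γ(z) = O((1 + |z|) ^ δ)` in the closed right half plane, uniformly. -/
lemma exists_norm_Gamma_add_le {δ : ℝ} (h0 : 0 < δ) : ∃ C : ℝ, 0 < C ∧ ∀ z : ℂ, 0 ≤ z.re →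
    ‖Complex.Gamma (z + δ)‖ * ‖(Complex.Gamma z)⁻¹‖ ≤ C * (1 + ‖z‖) ^ δ := by
  obtain ⟨m, hm⟩ : ∃ m : ℕ, δ ≤ m + 1 := ⟨⌈δ⌉₊, (Nat.le_ceil δ).trans (by linarith)⟩
  induction m generalizing δ with
  | zero =>
    refine ⟨Real.exp 1, Real.exp_pos _, fun z hz => ?_⟩
    rcases eq_or_ne z 0 with rfl | hz0
    · simp; positivity
    · have h := norm_Gamma_add_le_of_le_one hz hz0 h0.le (by simpa using hm)
      have hΓ : 0 < ‖Complex.Gamma z‖ := by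
        refine norm_pos_iff.2 (Complex.Gamma_ne_zero fun k hk => ?_)
        rw [hk] at hz hz0
        simp at hz hz0
        exact hz0 (by exact_mod_cast hz)
      rw [norm_inv, ← div_eq_mul_inv, div_le_iff₀ hΓ]
      exact h
  | succ m ih =>
    rcases le_or_gt δ 1 with h1 | h1
    · exact ih h0 (by have : (0 : ℝ) ≤ m := Nat.cast_nonneg m; linarith)
    · obtain ⟨C, hC, hb⟩ := ih (δ := δ - 1) (by linarith) (by push_cast at hm; linarith)
      refine ⟨δ * C, by positivity, fun z hz => ?_⟩
      have hne : z + (δ - 1 : ℝ) ≠ 0 := by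
        intro h
        have := congrArg Complex.re h
        simp at this
        linarith
      have e1 : z + δ = z + (δ - 1 : ℝ) + 1 := by push_cast; ring
      rw [e1, Complex.Gamma_add_one _ hne, norm_mul, mul_assoc]
      have h2 : ‖z + (δ - 1 : ℝ)‖ ≤ δ * (1 + ‖z‖) := by
        refine (norm_add_le _ _).trans ?_
        rw [Complex.norm_of_nonneg (by linarith)]
        nlinarith [norm_nonneg z]
      calc _ ≤ (δ * (1 + ‖z‖)) * (C * (1 + ‖z‖) ^ (δ - 1)) := by
            have := hb z hz
            gcongr
        _ = δ * C * ((1 + ‖z‖) ^ (δ - 1) * (1 + ‖z‖)) := by ring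
        _ = _ := by
          rw [← Real.rpow_add_one (by positivity)]
          simp

/-! ### The spectral weight -/

/-- One of the two factors of `shiftedWeight`, as a function of `s = i l`. -/
def weightFactor (α β : ℝ) (s : ℂ) : ℂ :=
  Complex.Gamma (((rho α β : ℂ) + 1 + s) / 2) * (Complex.Gamma ((1 + s) / 2))⁻¹ *
    (Complex.Gamma (((α : ℂ) - β + 2 + s) / 2) * (Complex.Gamma ((2 + s) / 2))⁻¹)

/-- The product of the coefficient of the difference equation with the analytic continuation of
`|c(l)|⁻²`, recentred by `l ↦ l - i`. It is even, and holomorphic in a neighbourhood of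
`|im l| ≤ 1`. -/
def shiftedWeight (α β : ℝ) (l : ℂ) : ℂ :=
  (((4 : ℝ) ^ (-(rho α β + 1)) : ℝ) : ℂ) * weightFactor α β (Complex.I * l) *
    weightFactor α β (-(Complex.I * l))

section

variable {α β : ℝ}

lemma shiftedWeight_neg (l : ℂ) : shiftedWeight α β (-l) = shiftedWeight α β l := by
  simp only [shiftedWeight, mul_neg, neg_neg]
  ring

lemma differentiableAt_weightFactor (hρ : 0 < rho α β) (hαβ : β < α) {s : ℂ} (hs : -1 ≤ s.re) :
    DifferentiableAt ℂ (weightFactor α β) s := by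
  unfold weightFactor
  have hg : ∀ w : ℂ, 0 < w.re → DifferentiableAt ℂ Complex.Gamma w := by
    intro w hw
    refine Complex.differentiableAt_Gamma _ fun m h => ?_
    rw [h] at hw
    simp at hw
    linarith [(Nat.cast_nonneg m : (0 : ℝ) ≤ m)]
  have hi : ∀ w : ℂ, DifferentiableAt ℂ (fun w => (Complex.Gamma w)⁻¹) w :=
    fun w => Complex.differentiable_one_div_Gamma w
  have h1 := (hg (((rho α β : ℂ) + 1 + s) / 2) (by simp; linarith)).comp s
    (f := fun s => ((rho α β : ℂ) + 1 + s) / 2) (by fun_prop)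
  have h2 := (hi ((1 + s) / 2)).comp s (f := fun s => (1 + s) / 2) (by fun_prop)
  have h3 := (hg (((α : ℂ) - β + 2 + s) / 2) (by simp; linarith)).comp s
    (f := fun s => ((α : ℂ) - β + 2 + s) / 2) (by fun_prop)
  have h4 := (hi ((2 + s) / 2)).comp s (f := fun s => (2 + s) / 2) (by fun_prop)
  exact (h1.mul h2).mul (h3.mul h4)

lemma differentiableAt_shiftedWeight (hρ : 0 < rho α β) (hαβ : β < α) {l : ℂ} (hl : |l.im| ≤ 1) :
    DifferentiableAt ℂ (shiftedWeight α β) l := by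
  unfold shiftedWeight
  obtain ⟨h1, h2⟩ := abs_le.1 hl
  have e1 := (differentiableAt_weightFactor hρ hαβ (s := Complex.I * l) (by simp; linarith)).comp l
    (f := fun l => Complex.I * l) (by fun_prop)
  have e2 := (differentiableAt_weightFactor hρ hαβ (s := -(Complex.I * l)) (by simp; linarith)).comp
    l (f := fun l => -(Complex.I * l)) (by fun_prop)
  exact (e1.const_mul _).mul e2

lemma exists_norm_weightFactor_le (hρ : 0 < rho α β) (hαβ : β < α) : ∃ C : ℝ, 0 < C ∧ ∀ s : ℂ,
    -1 ≤ s.re → ‖weightFactor α β s‖ ≤ C * (1 + ‖s‖) ^ (α + 1 / 2) := by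
  obtain ⟨C1, hC1, h1⟩ := exists_norm_Gamma_add_le (δ := rho α β / 2) (by linarith)
  obtain ⟨C2, hC2, h2⟩ := exists_norm_Gamma_add_le (δ := (α - β) / 2) (by linarith)
  refine ⟨C1 * C2 * 2 ^ (α + 1 / 2), by positivity, fun s hs => ?_⟩
  have hz : ∀ z : ℂ, ‖z‖ ≤ 1 + ‖s‖ / 2 → 1 + ‖z‖ ≤ 2 * (1 + ‖s‖) := fun z hz => by
    linarith [norm_nonneg s]
  have n1 : ‖(1 + s) / 2‖ ≤ 1 + ‖s‖ / 2 := by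
    rw [norm_div, Complex.norm_ofNat]
    have := norm_add_le 1 s
    rw [norm_one] at this
    linarith
  have n2 : ‖(2 + s) / 2‖ ≤ 1 + ‖s‖ / 2 := by
    rw [norm_div, Complex.norm_ofNat]
    have := norm_add_le 2 s
    rw [Complex.norm_ofNat] at this
    linarith
  have e1 := h1 ((1 + s) / 2) (by simp; linarith)
  have e2 := h2 ((2 + s) / 2) (by simp; linarith)
  have r1 : (1 + s) / 2 + ((rho α β / 2 : ℝ) : ℂ) = ((rho α β : ℂ) + 1 + s) / 2 := by
    push_cast; ring
  have r2 : (2 + s) / 2 + (((α - β) / 2 : ℝ) : ℂ) = ((α : ℂ) - β + 2 + s) / 2 := by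
    push_cast; ring
  rw [r1] at e1
  rw [r2] at e2
  rw [weightFactor, norm_mul, norm_mul, norm_mul]
  have hsum : rho α β / 2 + (α - β) / 2 = α + 1 / 2 := by simp only [rho]; ring
  have hs0 : 0 ≤ 1 + ‖s‖ := by positivity
  calc _ ≤ (C1 * (1 + ‖(1 + s) / 2‖) ^ (rho α β / 2)) *
        (C2 * (1 + ‖(2 + s) / 2‖) ^ ((α - β) / 2)) := by gcongr
    _ ≤ (C1 * (2 * (1 + ‖s‖)) ^ (rho α β / 2)) * (C2 * (2 * (1 + ‖s‖)) ^ ((α - β) / 2)) := by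
      have p1 := hz _ n1
      have p2 := hz _ n2
      have q1 : 0 ≤ rho α β / 2 := by linarith
      have q2 : 0 ≤ (α - β) / 2 := by linarith
      gcongr
    _ = C1 * C2 * ((2 * (1 + ‖s‖)) ^ (rho α β / 2) * (2 * (1 + ‖s‖)) ^ ((α - β) / 2)) := by ring
    _ = _ := by
      rw [← Real.rpow_add (by positivity), hsum, Real.mul_rpow (by norm_num) hs0]
      ring

lemma exists_norm_shiftedWeight_le (hρ : 0 < rho α β) (hαβ : β < α) : ∃ C : ℝ, 0 < C ∧ ∀ l : ℂ,
    |l.im| ≤ 1 → ‖shiftedWeight α β l‖ ≤ C * ((1 + ‖l‖) ^ (α + 1 / 2)) ^ 2 := by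
  obtain ⟨C, hC, h⟩ := exists_norm_weightFactor_le hρ hαβ
  refine ⟨(4 : ℝ) ^ (-(rho α β + 1)) * C ^ 2, by positivity, fun l hl => ?_⟩
  obtain ⟨h1, h2⟩ := abs_le.1 hl
  have e1 := h (Complex.I * l) (by simp; linarith)
  have e2 := h (-(Complex.I * l)) (by simp; linarith)
  rw [norm_neg] at e2
  rw [norm_mul, Complex.norm_I, one_mul] at e1 e2
  rw [shiftedWeight, norm_mul, norm_mul, Complex.norm_of_nonneg (by positivity)]
  calc _ ≤ (4 : ℝ) ^ (-(rho α β + 1)) * (C * (1 + ‖l‖) ^ (α + 1 / 2)) *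
        (C * (1 + ‖l‖) ^ (α + 1 / 2)) := by gcongr
    _ = _ := by ring

lemma conj_cFun (l : ℝ) : (starRingEnd ℂ) (cFun α β l) = cFun α β (-l) := by
  have h2 : (starRingEnd ℂ) ((2 : ℂ) ^ (rho α β : ℂ)) = (2 : ℂ) ^ (rho α β : ℂ) := by
    have : (2 : ℂ) ^ (rho α β : ℂ) = (((2 : ℝ) ^ rho α β : ℝ) : ℂ) := by
      rw [Complex.ofReal_cpow (by norm_num)]; norm_num
    rw [this, Complex.conj_ofReal]
  simp only [cFun, map_div₀, map_mul, h2, ← Complex.Gamma_conj, map_add, map_sub, Complex.conj_I,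
    Complex.conj_ofReal, map_one, map_ofNat, Complex.ofReal_neg, mul_neg, neg_mul]

/-- By `Γ(z + 1) = z Γ(z)`, the coefficient of the difference equation raises the arguments of the
four Gamma functions in `c(-l)` by one. This turns `1 / (c(l) c(-l))` into a function that is even
about `l = -i`, which is the symmetry of the difference operator. -/
lemma diffCoeff_mul_weight (hρ : 0 < rho α β) (hαβ : β < α) {l : ℝ} (hl : l ≠ 0) :
    diffCoeff α β l * (((‖cFun α β l‖ ^ 2)⁻¹ : ℝ) : ℂ) = shiftedWeight α β (l + Complex.I) := by
  -- in this form the weight continues holomorphically in `l`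
  have hnorm : ((‖cFun α β l‖ ^ 2 : ℝ) : ℂ) = cFun α β l * cFun α β (-l) := by
    rw [← conj_cFun, Complex.mul_conj']
    push_cast
    rfl
  rw [Complex.ofReal_inv, hnorm]
  set s : ℂ := Complex.I * l with hs
  have hsre : s.re = 0 := by simp [hs]
  have hs0 : s ≠ 0 := mul_ne_zero Complex.I_ne_zero (by exact_mod_cast hl)
  have hre : ∀ w : ℂ, w.re ≠ 0 → w ≠ 0 := fun w hw h => hw (by simp [h])
  have e0 : Complex.I * (l + Complex.I) = s - 1 := by
    rw [mul_add, Complex.I_mul_I]; ring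
  have g1 : Complex.Gamma (((rho α β : ℂ) + 1 + -(s - 1)) / 2)
      = ((rho α β : ℂ) - s) / 2 * Complex.Gamma (((rho α β : ℂ) - s) / 2) := by
    rw [← Complex.Gamma_add_one _ (hre _ (by simp [hsre]; linarith))]
    congr 1; ring
  have g2 : Complex.Gamma ((1 + -(s - 1)) / 2) = -s / 2 * Complex.Gamma (-s / 2) := by
    rw [← Complex.Gamma_add_one _ (div_ne_zero (neg_ne_zero.2 hs0) two_ne_zero)]
    congr 1; ring
  have g3 : Complex.Gamma (((α : ℂ) - β + 2 + -(s - 1)) / 2)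
      = ((α : ℂ) - β + 1 - s) / 2 * Complex.Gamma (((α : ℂ) - β + 1 - s) / 2) := by
    rw [← Complex.Gamma_add_one _ (hre _ (by simp [hsre]; linarith))]
    congr 1; ring
  have g4 : Complex.Gamma ((2 + -(s - 1)) / 2) = (1 - s) / 2 * Complex.Gamma ((1 - s) / 2) := by
    rw [← Complex.Gamma_add_one _ (hre _ (by simp [hsre]))]
    congr 1; ring
  have f1 : ((rho α β : ℂ) + 1 + (s - 1)) / 2 = ((rho α β : ℂ) + s) / 2 := by ring
  have f2 : (1 + (s - 1)) / 2 = s / 2 := by ring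
  have f3 : ((α : ℂ) - β + 2 + (s - 1)) / 2 = ((rho α β : ℂ) + s) / 2 - β := by
    simp only [rho]; push_cast; ring
  have f4 : (2 + (s - 1)) / 2 = (1 + s) / 2 := by ring
  have f5 : ((α : ℂ) - β + 1 - s) / 2 = ((rho α β : ℂ) - s) / 2 - β := by
    simp only [rho]; push_cast; ring
  have h4 : (((4 : ℝ) ^ (-(rho α β + 1)) : ℝ) : ℂ)
      = (4 * ((2 : ℂ) ^ (rho α β : ℂ) * (2 : ℂ) ^ (rho α β : ℂ)))⁻¹ := by
    have : (2 : ℂ) ^ (rho α β : ℂ) = (((2 : ℝ) ^ rho α β : ℝ) : ℂ) := by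
      rw [Complex.ofReal_cpow (by norm_num)]; norm_num
    rw [this, Real.rpow_neg (by norm_num), Real.rpow_add (by norm_num), Real.rpow_one]
    have h22 : (4 : ℝ) ^ rho α β = 2 ^ rho α β * 2 ^ rho α β := by
      rw [← Real.mul_rpow (by norm_num) (by norm_num)]; norm_num
    rw [h22]
    push_cast
    ring
  have k1 : Complex.I * ((-l : ℝ) : ℂ) = -s := by rw [hs]; push_cast; ring
  rw [shiftedWeight, e0, weightFactor, weightFactor, g1, g2, g3, g4, f1, f2, f3, f4, f5, h4, cFun,
    cFun, ← hs, k1, diffCoeff, ← hs, f5, ← sub_eq_add_neg, ← sub_eq_add_neg]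
  -- the Gamma functions now match one by one, and the rest is rational
  generalize Complex.Gamma _ = G1
  generalize Complex.Gamma _ = G2
  generalize Complex.Gamma _ = G3
  generalize Complex.Gamma _ = G4
  generalize Complex.Gamma _ = G5
  generalize Complex.Gamma _ = G6
  generalize Complex.Gamma _ = G7
  generalize Complex.Gamma _ = G8
  have hs1 : s * (s - 1) = (-s / 2) * ((1 - s) / 2) * 4 := by ring
  rw [hs1]
  simp only [div_eq_mul_inv, mul_inv, inv_inv]
  ring

end

/-! ### The Christoffel–Darboux formula and the kernel estimate -/

/-- The boundary term of the Christoffel–Darboux formula. -/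
def cdTerm (α β t r : ℝ) (l : ℂ) : ℂ :=
  shiftedWeight α β l * (psi α β (l + Complex.I) t * psi α β (l - Complex.I) r -
    psi α β (l - Complex.I) t * psi α β (l + Complex.I) r)

section

variable {α β : ℝ}

lemma cdTerm_neg (hα : -(1 / 2) < α) (hβ : -(1 / 2) < β) {t r : ℝ} (ht : 0 < t) (hr : 0 < r)
    (l : ℂ) : cdTerm α β t r (-l) = -cdTerm α β t r l := by
  have e1 : -l + Complex.I = -(l - Complex.I) := by ring
  have e2 : -l - Complex.I = -(l + Complex.I) := by ring
  rw [cdTerm, cdTerm, shiftedWeight_neg, e1, e2, psi_neg hα hβ _ ht, psi_neg hα hβ _ hr,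
    psi_neg hα hβ _ ht, psi_neg hα hβ _ hr]
  ring

lemma differentiableAt_cdTerm (hα : -1 < α) (hρ : 0 < rho α β) (hαβ : β < α) (t r : ℝ) {l : ℂ}
    (hl : |l.im| ≤ 1) : DifferentiableAt ℂ (cdTerm α β t r) l := by
  have hp : ∀ s : ℝ, DifferentiableAt ℂ (fun l => psi α β (l + Complex.I) s) l := fun s =>
    ((differentiable_psi hα s).comp (f := fun l => l + Complex.I) (by fun_prop)) l
  have hm : ∀ s : ℝ, DifferentiableAt ℂ (fun l => psi α β (l - Complex.I) s) l := fun s =>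
    ((differentiable_psi hα s).comp (f := fun l => l - Complex.I) (by fun_prop)) l
  exact (differentiableAt_shiftedWeight hρ hαβ hl).mul
    (((hp t).mul (hm r)).sub ((hm t).mul (hp r)))

/-- The difference equations at `t` and `r` combine; the terms without shift cancel. -/
lemma cdTerm_sub (hα : -(1 / 2) < α) (hβ : -(1 / 2) < β) (hρ : 0 < rho α β) (hαβ : β < α)
    {t r : ℝ} (ht : 0 < t) (hr : 0 < r) {l : ℝ} (hl : l ≠ 0) :
    ((Real.sinh t : ℂ) ^ 2 - (Real.sinh r : ℂ) ^ 2) *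
        (jacobiPhi α β l t * jacobiPhi α β l r * (((‖cFun α β l‖ ^ 2)⁻¹ : ℝ) : ℂ))
      = cdTerm α β t r (l + Complex.I) - cdTerm α β t r (l - Complex.I) := by
  have h0 : Complex.I * (l : ℂ) ≠ 0 := mul_ne_zero Complex.I_ne_zero (by exact_mod_cast hl)
  have h1 : Complex.I * (l : ℂ) - 1 ≠ 0 := fun h => by
    have := congrArg Complex.re h
    simp at this
  have h2 : Complex.I * (l : ℂ) + 1 ≠ 0 := fun h => by
    have := congrArg Complex.re h
    simp at this
  have dt := psi_difference_equation (β := β) (by linarith : -1 < α) h0 h1 h2 t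
  have dr := psi_difference_equation (β := β) (by linarith : -1 < α) h0 h1 h2 r
  have w1 := diffCoeff_mul_weight hρ hαβ hl
  have w2 : diffCoeff α β (-(l : ℂ)) * (((‖cFun α β l‖ ^ 2)⁻¹ : ℝ) : ℂ)
      = shiftedWeight α β (l - Complex.I) := by
    have := diffCoeff_mul_weight hρ hαβ (neg_ne_zero.2 hl)
    rw [← conj_cFun, Complex.norm_conj, Complex.ofReal_neg] at this
    rw [this, ← shiftedWeight_neg]
    congr 1
    ring
  have e1 : (l : ℂ) + Complex.I + Complex.I = l + 2 * Complex.I := by ring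
  have e2 : (l : ℂ) + Complex.I - Complex.I = l := by ring
  have e3 : (l : ℂ) - Complex.I + Complex.I = l := by ring
  have e4 : (l : ℂ) - Complex.I - Complex.I = l - 2 * Complex.I := by ring
  rw [jacobiPhi_eq_psi hα hβ l ht, jacobiPhi_eq_psi hα hβ l hr, cdTerm, cdTerm, e1, e2, e3, e4,
    ← w1, ← w2]
  linear_combination (-psi α β l r * (((‖cFun α β l‖ ^ 2)⁻¹ : ℝ) : ℂ)) * dt
    + (psi α β l t * (((‖cFun α β l‖ ^ 2)⁻¹ : ℝ) : ℂ)) * dr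

/-- The Christoffel–Darboux formula in the spectral variable: multiplied by the difference of the
eigenvalues, the kernel becomes a contour integral over a vertical segment at `R`. -/
lemma sinh_sq_sub_mul_kernel (hα : -(1 / 2) < α) (hβ : -(1 / 2) < β) (hρ : 0 < rho α β)
    (hαβ : β < α) {t r : ℝ} (ht : 0 < t) (hr : 0 < r) {R : ℝ} (hR : 0 < R) :
    ((Real.sinh t : ℂ) ^ 2 - (Real.sinh r : ℂ) ^ 2) * kernel α β R t r
      = Complex.I * ∫ y in (-1 : ℝ)..1, cdTerm α β t r (R + y * Complex.I) := by
  have hd : DifferentiableOn ℂ (cdTerm α β t r) {z | |z.im| ≤ 1} := fun z hz =>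
    (differentiableAt_cdTerm (by linarith) hρ hαβ t r hz).differentiableWithinAt
  have hrect := Complex.integral_boundary_rect_eq_zero_of_differentiableOn (cdTerm α β t r)
    (-Complex.I) (R + Complex.I) (hd.mono ?_)
  · -- the left side of the rectangle contributes nothing, by oddness
    have hodd : ∫ y in (-1 : ℝ)..1, cdTerm α β t r ((0 : ℝ) + y * Complex.I) = 0 := by
      have h1 := intervalIntegral.integral_comp_neg (a := -1) (b := 1)
        (fun y : ℝ => cdTerm α β t r ((0 : ℝ) + y * Complex.I))
      have h2 : ∀ y : ℝ, cdTerm α β t r ((0 : ℝ) + ((-y : ℝ) : ℂ) * Complex.I)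
          = -cdTerm α β t r ((0 : ℝ) + y * Complex.I) := by
        intro y
        rw [← cdTerm_neg hα hβ ht hr]
        congr 1
        push_cast
        ring
      simp only [h2, neg_neg, intervalIntegral.integral_neg] at h1
      exact self_eq_neg.1 h1.symm
    have hcont : ∀ σ : ℝ, |σ| ≤ 1 →
        IntervalIntegrable (fun x : ℝ => cdTerm α β t r (x + σ * Complex.I)) volume 0 R := by
      intro σ hσ
      refine Continuous.intervalIntegrable ?_ _ _
      refine hd.continuousOn.comp_continuous (by fun_prop) fun x => ?_
      simpa using hσ
    have hp := hcont 1 (by simp)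
    have hm := hcont (-1) (by simp)
    simp only [Complex.neg_re, Complex.I_re, neg_zero, Complex.add_re, Complex.ofReal_re, add_zero,
      Complex.neg_im, Complex.I_im, Complex.add_im, Complex.ofReal_im, zero_add,
      smul_eq_mul] at hrect
    rw [hodd] at hrect
    rw [kernel, ← intervalIntegral.integral_const_mul]
    have hcongr : ∫ l in (0 : ℝ)..R, ((Real.sinh t : ℂ) ^ 2 - (Real.sinh r : ℂ) ^ 2) *
        (jacobiPhi α β l t * jacobiPhi α β l r * (((‖cFun α β l‖ ^ 2)⁻¹ : ℝ) : ℂ))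
        = ∫ l in (0 : ℝ)..R, (cdTerm α β t r (l + ((1 : ℝ) : ℂ) * Complex.I)
          - cdTerm α β t r (l + ((-1 : ℝ) : ℂ) * Complex.I)) := by
      -- the interval `(0, R]` avoids `l = 0`, where the coefficients have a pole
      refine intervalIntegral.integral_congr_ae (Eventually.of_forall fun l hl => ?_)
      rw [uIoc_of_le hR.le] at hl
      rw [cdTerm_sub hα hβ hρ hαβ ht hr hl.1.ne']
      simp [sub_eq_add_neg]
    rw [hcongr, intervalIntegral.integral_sub hp hm]
    linear_combination (-1 : ℂ) * hrect
  · intro z hz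
    have h := hz.2
    simp only [Complex.neg_im, Complex.I_im, Complex.add_im, Complex.ofReal_im, zero_add,
      mem_preimage] at h
    rw [uIcc_of_le (by norm_num)] at h
    exact abs_le.2 h

/-- The integration along the segment gains the factor `1 / t` over `e^(2t)`. -/
lemma integral_exp_segment {t : ℝ} (ht : 1 < t) :
    ∫ y in (-1 : ℝ)..1,
      (Real.exp (|y + 1| * t) + Real.exp t + (Real.exp (|y - 1| * t) + Real.exp t))
      ≤ 6 * (Real.exp (2 * t) / t) := by
  have ht0 : 0 < t := by linarith
  have hc : ∫ y in (-1 : ℝ)..1,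
      (Real.exp (|y + 1| * t) + Real.exp t + (Real.exp (|y - 1| * t) + Real.exp t))
      = ∫ y in (-1 : ℝ)..1, (Real.exp ((y + 1) * t) + Real.exp ((1 - y) * t) + 2 * Real.exp t) := by
    refine intervalIntegral.integral_congr fun y hy => ?_
    rw [uIcc_of_le (by norm_num)] at hy
    rw [abs_of_nonneg (by linarith [hy.1]), abs_of_nonpos (by linarith [hy.2])]
    ring_nf
  have hd : ∀ y ∈ uIcc (-1 : ℝ) 1, HasDerivAt (fun y => (Real.exp ((y + 1) * t) -
      Real.exp ((1 - y) * t)) / t + y * (2 * Real.exp t))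
      (Real.exp ((y + 1) * t) + Real.exp ((1 - y) * t) + 2 * Real.exp t) y := by
    intro y _
    have h1 := (((hasDerivAt_id y).add_const 1).mul_const t).exp
    have h2 := (((hasDerivAt_id y).const_sub 1).mul_const t).exp
    refine (((h1.sub h2).div_const t).add
      ((hasDerivAt_id y).mul_const (2 * Real.exp t))).congr_deriv ?_
    simp only [id]
    field_simp
    ring
  rw [hc, intervalIntegral.integral_eq_sub_of_hasDerivAt hd
    (Continuous.intervalIntegrable (by fun_prop) _ _)]
  have h2 : Real.exp t ≤ Real.exp (2 * t) / t := by
    rw [le_div_iff₀ ht0, two_mul, Real.exp_add]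
    have := Real.add_one_le_exp t
    gcongr
    linarith
  have h3 : 0 ≤ 1 / t := by positivity
  have e1 : ((1 : ℝ) + 1) * t = 2 * t := by ring
  have e2 : ((1 : ℝ) - 1) * t = 0 := by ring
  have e3 : ((-1 : ℝ) + 1) * t = 0 := by ring
  have e4 : ((1 : ℝ) - -1) * t = 2 * t := by ring
  rw [e1, e2, e3, e4, Real.exp_zero]
  have e5 : (Real.exp (2 * t) - 1) / t = Real.exp (2 * t) / t - 1 / t := by ring
  have e6 : (1 - Real.exp (2 * t)) / t = 1 / t - Real.exp (2 * t) / t := by ring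
  rw [e5, e6]
  linarith

/-- Separation of the eigenvalues off the diagonal. -/
lemma exp_le_sinh_sq_sub {t r : ℝ} (ht : 1 < t) (hr : 0 < r) (hrt : r ≤ t / 2) :
    Real.exp (2 * t) / 32 ≤ Real.sinh t ^ 2 - Real.sinh r ^ 2 := by
  have h1 : Real.sinh r ≤ Real.sinh (t / 2) := Real.sinh_le_sinh.2 hrt
  have h2 : 2 * Real.sinh (t / 2) ≤ Real.sinh t := by
    have h := Real.sinh_two_mul (t / 2)
    rw [mul_div_cancel₀ t two_ne_zero] at h
    rw [h]
    have h3 : 0 ≤ Real.sinh (t / 2) := Real.sinh_nonneg_iff.2 (by linarith)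
    have h4 := Real.one_le_cosh (t / 2)
    nlinarith
  have h0 : 0 < Real.sinh r := Real.sinh_pos_iff.2 hr
  have h5 : Real.exp t / 4 ≤ Real.sinh t := by
    rw [Real.sinh_eq, Real.exp_neg]
    have h6 : 2 ≤ Real.exp t := by linarith [Real.add_one_le_exp t]
    have h7 : (Real.exp t)⁻¹ ≤ 1 := inv_le_one_of_one_le₀ (by linarith)
    linarith
  have h8 : Real.exp (2 * t) = Real.exp t ^ 2 := by rw [← Real.exp_nat_mul]; norm_num
  have h9 : Real.sinh r ^ 2 ≤ (Real.sinh t / 2) ^ 2 := by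
    have : Real.sinh r ≤ Real.sinh t / 2 := by linarith
    gcongr
  have h10 : (Real.exp t / 4) ^ 2 ≤ Real.sinh t ^ 2 := by gcongr
  rw [h8]
  nlinarith [sq_nonneg (Real.exp t)]

lemma rpow_le_sqrtDelta (hα : -(1 / 2) < α) (hβ : -(1 / 2) < β) {r : ℝ} (hr : 0 < r) :
    r ^ (α + 1 / 2) ≤ sqrtDelta α β r := by
  have h1 : r ≤ 2 * Real.sinh r := by
    have := Real.self_le_sinh_iff.2 hr.le
    linarith
  have h2 : 1 ≤ 2 * Real.cosh r := by linarith [Real.one_le_cosh r]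
  have h3 : r ^ (α + 1 / 2) ≤ (2 * Real.sinh r) ^ (α + 1 / 2) :=
    Real.rpow_le_rpow hr.le h1 (by linarith)
  have h4 : 1 ≤ (2 * Real.cosh r) ^ (β + 1 / 2) := Real.one_le_rpow h2 (by linarith)
  unfold sqrtDelta
  exact h3.trans (le_mul_of_one_le_right ((by positivity : 0 ≤ r ^ (α + 1 / 2)).trans h3) h4)

/-- On the vertical segment the powers of `R` coming from the weight and from the two Jacobi
functions cancel. -/
lemma exists_norm_cdTerm_le (hα : -(1 / 2) < α) (hβ : -(1 / 2) < β) (hρ : 0 < rho α β)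
    (hαβ : β < α) : ∃ C : ℝ, 0 < C ∧ ∀ R t r y : ℝ, 0 < R → 0 < t → 0 < r → r ≤ 1 → |y| ≤ 1 →
    ‖cdTerm α β t r (R + y * Complex.I)‖ ≤ C * (r ^ (-(α + 1 / 2)) / sqrtDelta α β t) *
      (Real.exp (|y + 1| * t) + Real.exp t + (Real.exp (|y - 1| * t) + Real.exp t)) := by
  obtain ⟨C₁, hC₁, hψ⟩ := exists_bound_psi hα hβ
  obtain ⟨C₂, hC₂, hG⟩ := exists_norm_shiftedWeight_le hρ hαβ
  set a := α + 1 / 2 with ha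
  have ha0 : 0 < a := by linarith
  refine ⟨C₂ * (4 ^ a) ^ 2 * (C₁ * (C₁ * (2 * Real.exp 2))), by positivity, ?_⟩
  intro R t r y hR ht hr hr1 hy
  obtain ⟨hy1, hy2⟩ := abs_le.1 hy
  set ν : ℂ := R + y * Complex.I with hν
  have him : ν.im = y := by simp [hν]
  have hre : ν.re = R := by simp [hν]
  set k := (1 + R) / 2 with hk
  have hk0 : 0 < k := by positivity
  have hbase : ∀ l : ℂ, l.re = R → (max 1 ‖l‖) ^ (-a) ≤ k ^ (-a) := by
    intro l hl
    refine Real.rpow_le_rpow_of_nonpos hk0 ?_ (by linarith)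
    have h1 : R ≤ ‖l‖ := hl ▸ Complex.re_le_norm l
    have h2 := le_max_left 1 ‖l‖
    have h3 := h1.trans (le_max_right 1 ‖l‖)
    rw [hk]
    linarith
  have hqt := sqrtDelta_pos (α := α) (β := β) ht
  have hqr := sqrtDelta_pos (α := α) (β := β) hr
  have hT : ∀ l : ℂ, l.re = R → ‖psi α β l t‖ ≤
      C₁ * k ^ (-a) * (Real.exp (|l.im| * t) + Real.exp t) / sqrtDelta α β t := by
    intro l hl
    refine (hψ l t ht).trans ?_
    have := hbase l hl
    gcongr
  have hRb : ∀ l : ℂ, l.re = R → |l.im| ≤ 2 → ‖psi α β l r‖ ≤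
      C₁ * k ^ (-a) * (2 * Real.exp 2) * r ^ (-a) := by
    intro l hl hl2
    refine (hψ l r hr).trans ?_
    have h1 := hbase l hl
    have h2 : Real.exp (|l.im| * r) ≤ Real.exp 2 := by
      rw [Real.exp_le_exp]
      calc |l.im| * r ≤ 2 * 1 := by gcongr
        _ = 2 := by ring
    have h3 : Real.exp r ≤ Real.exp 2 := by rw [Real.exp_le_exp]; linarith
    have h4 := rpow_le_sqrtDelta hα hβ hr
    have h5 : 0 < r ^ a := by positivity
    rw [Real.rpow_neg hr.le, div_eq_mul_inv]
    gcongr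
    linarith
  have hGν : ‖shiftedWeight α β ν‖ ≤ C₂ * (4 ^ a * k ^ a) ^ 2 := by
    refine (hG ν (by rwa [him])).trans ?_
    have h1 : ‖ν‖ ≤ R + 1 := by
      refine (Complex.norm_le_abs_re_add_abs_im ν).trans ?_
      rw [him, hre, abs_of_pos hR]
      linarith
    rw [← Real.mul_rpow (by norm_num) hk0.le]
    have h2 : 1 + ‖ν‖ ≤ 4 * k := by rw [hk]; linarith
    gcongr
  have i1 : (ν + Complex.I).im = y + 1 := by simp [him]
  have i2 : (ν - Complex.I).im = y - 1 := by simp [him]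
  have r1 : (ν + Complex.I).re = R := by simp [hre]
  have r2 : (ν - Complex.I).re = R := by simp [hre]
  have a1 : |y + 1| ≤ 2 := abs_le.2 ⟨by linarith, by linarith⟩
  have a2 : |y - 1| ≤ 2 := abs_le.2 ⟨by linarith, by linarith⟩
  have t1 := hT _ r1
  have t2 := hT _ r2
  have u1 := hRb _ r1 (by rwa [i1])
  have u2 := hRb _ r2 (by rwa [i2])
  rw [i1] at t1
  rw [i2] at t2
  have hkk : k ^ a * k ^ (-a) = 1 := by
    rw [← Real.rpow_add hk0]; simp
  set E1 := Real.exp (|y + 1| * t) + Real.exp t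
  set E2 := Real.exp (|y - 1| * t) + Real.exp t
  rw [cdTerm, norm_mul]
  have hsub : ‖psi α β (ν + Complex.I) t * psi α β (ν - Complex.I) r -
      psi α β (ν - Complex.I) t * psi α β (ν + Complex.I) r‖ ≤
      (C₁ * k ^ (-a) * E1 / sqrtDelta α β t) * (C₁ * k ^ (-a) * (2 * Real.exp 2) * r ^ (-a)) +
      (C₁ * k ^ (-a) * E2 / sqrtDelta α β t) * (C₁ * k ^ (-a) * (2 * Real.exp 2) * r ^ (-a)) := by
    refine (norm_sub_le _ _).trans ?_
    rw [norm_mul, norm_mul]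
    gcongr
  calc _ ≤ (C₂ * (4 ^ a * k ^ a) ^ 2) *
      ((C₁ * k ^ (-a) * E1 / sqrtDelta α β t) * (C₁ * k ^ (-a) * (2 * Real.exp 2) * r ^ (-a)) +
      (C₁ * k ^ (-a) * E2 / sqrtDelta α β t) * (C₁ * k ^ (-a) * (2 * Real.exp 2) * r ^ (-a))) := by
        gcongr
    _ = C₂ * (4 ^ a) ^ 2 * (C₁ * (C₁ * (2 * Real.exp 2))) * (r ^ (-a) / sqrtDelta α β t) *
        (E1 + E2) * (k ^ a * k ^ (-a)) ^ 2 := by ring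
    _ = _ := by rw [hkk]; ring

/-- The kernel estimate off the diagonal. It is uniform in `R`. -/
theorem exists_norm_kernel_le (hα : -(1 / 2) < α) (hβ : -(1 / 2) < β) (hρ : 0 < rho α β)
    (hαβ : β < α) : ∃ C : ℝ, 0 < C ∧ ∀ R t r : ℝ, 0 < R → 1 < t → 0 < r → r ≤ 1 → r ≤ t / 2 →
    ‖kernel α β R t r‖ ≤ C * (t * sqrtDelta α β t)⁻¹ * r ^ (-(α + 1 / 2)) := by
  obtain ⟨C, hC, h⟩ := exists_norm_cdTerm_le hα hβ hρ hαβ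
  refine ⟨192 * C, by positivity, ?_⟩
  intro R t r hR ht hr hr1 hrt
  have ht0 : 0 < t := by linarith
  have hq := sqrtDelta_pos (α := α) (β := β) ht0
  have hid := sinh_sq_sub_mul_kernel hα hβ hρ hαβ ht0 hr hR
  have hint : ‖∫ y in (-1 : ℝ)..1, cdTerm α β t r (R + y * Complex.I)‖ ≤
      C * (r ^ (-(α + 1 / 2)) / sqrtDelta α β t) * (6 * (Real.exp (2 * t) / t)) := by
    refine (intervalIntegral.norm_integral_le_of_norm_le (by norm_num)
      (Eventually.of_forall fun y hy => h R t r y hR ht0 hr hr1 (abs_le.2 ⟨hy.1.le, hy.2⟩))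
      (Continuous.intervalIntegrable (by fun_prop) _ _)).trans ?_
    rw [intervalIntegral.integral_const_mul]
    have := integral_exp_segment ht
    gcongr
  have hs := exp_le_sinh_sq_sub ht hr hrt
  have hE := Real.exp_pos (2 * t)
  have hn := congrArg norm hid
  have hreal : ((Real.sinh t : ℂ) ^ 2 - (Real.sinh r : ℂ) ^ 2)
      = ((Real.sinh t ^ 2 - Real.sinh r ^ 2 : ℝ) : ℂ) := by
    simp only [Complex.ofReal_sub, Complex.ofReal_pow]
  rw [norm_mul, norm_mul, Complex.norm_I, one_mul, hreal,
    Complex.norm_of_nonneg (by linarith [div_pos hE (by norm_num : (0 : ℝ) < 32)])] at hn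
  rw [← hn] at hint
  have h2 : Real.exp (2 * t) / 32 * ‖kernel α β R t r‖ ≤
      C * (r ^ (-(α + 1 / 2)) / sqrtDelta α β t) * (6 * (Real.exp (2 * t) / t)) :=
    le_trans (by gcongr) hint
  have h3 : C * (r ^ (-(α + 1 / 2)) / sqrtDelta α β t) * (6 * (Real.exp (2 * t) / t))
      = Real.exp (2 * t) / 32 * (192 * C * (t * sqrtDelta α β t)⁻¹ * r ^ (-(α + 1 / 2))) := by
    field_simp
    norm_num
  rw [h3] at h2
  exact le_of_mul_le_mul_left h2 (by positivity)

end

/-! ### The weight `r ^ (-(α + 1 / 2))` and the Lorentz norm -/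

section

variable {α β : ℝ}

lemma measurable_Delta (α β : ℝ) : Measurable (Delta α β) := by
  unfold Delta
  have h1 := Real.measurable_sinh
  have h2 := Real.measurable_cosh
  fun_prop

lemma lintegral_mu {g : ℝ → ℝ≥0∞} {s : Set ℝ} (hs : MeasurableSet s) :
    ∫⁻ t in s, g t ∂(mu α β) = ∫⁻ t in s ∩ Ioi 0, ENNReal.ofReal (Delta α β t) * g t := by
  rw [mu, setLIntegral_withDensity_eq_setLIntegral_mul_non_measurable₀ _ _ _ hs,
    Measure.restrict_restrict hs]
  · rfl
  · exact Eventually.of_forall fun _ => ENNReal.ofReal_lt_top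
  · exact (measurable_Delta α β).ennreal_ofReal.aemeasurable

lemma ae_mu_pos : ∀ᵐ r ∂(mu α β), 0 < r := by
  unfold mu
  exact (withDensity_absolutelyContinuous _ _).ae_le (ae_restrict_mem measurableSet_Ioi)

lemma exists_Delta_le (hα : -(1 / 2) < α) (hβ : -(1 / 2) < β) : ∃ C : ℝ, 0 < C ∧
    ∀ r : ℝ, 0 < r → r ≤ 1 → Delta α β r ≤ C * (r ^ (α + 1 / 2)) ^ 2 := by
  have hc := Real.cosh_pos 1
  refine ⟨((2 * Real.cosh 1) ^ (α + 1 / 2) * (2 * Real.cosh 1) ^ (β + 1 / 2)) ^ 2,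
    by positivity, fun r hr hr1 => ?_⟩
  rw [← sqrtDelta_sq hr, ← mul_pow]
  have h := sqrtDelta_le hα hβ hr hr1
  have := sqrtDelta_pos (α := α) (β := β) hr
  gcongr

/-- The function `r ^ (-(α + 1 / 2))` on `(0, 1)` belongs to weak `L^{p₀'}(μ)`, the dual space of
`L^{p₀, 1}(μ)`; in terms of its integrals over sets this is the bound below. -/
lemma exists_lintegral_rpow_le (hα : -(1 / 2) < α) (hβ : -(1 / 2) < β) : ∃ C : ℝ≥0,
    ∀ E : Set ℝ, MeasurableSet E → E ⊆ Ioo 0 1 →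
      ∫⁻ r in E, ENNReal.ofReal (r ^ (-(α + 1 / 2))) ∂(mu α β) ≤
        C * mu α β E ^ (1 / p0 α) := by
  obtain ⟨C, hC, hΔ⟩ := exists_Delta_le hα hβ
  set a := α + 1 / 2 with ha
  have ha0 : 0 < a := by linarith
  refine ⟨C.toNNReal + 1, fun E hE hE1 => ?_⟩
  have hp : 1 / p0 α = (a + 1) / (2 * a + 1) := by
    rw [p0, one_div_div, ha, div_eq_div_iff (by linarith) (by linarith)]
    ring
  have hsmall : ∀ δ : ℝ, 0 < δ → ∫⁻ r in E ∩ Iio δ, ENNReal.ofReal (r ^ (-a)) ∂(mu α β)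
      ≤ ENNReal.ofReal (C * δ ^ (a + 1)) := by
    intro δ hδ
    rw [lintegral_mu (hE.inter measurableSet_Iio)]
    have hsub : (E ∩ Iio δ) ∩ Ioi 0 ⊆ Ioo 0 δ := fun r hr => ⟨hr.2, hr.1.2⟩
    calc _ ≤ ∫⁻ r in (E ∩ Iio δ) ∩ Ioi 0, ENNReal.ofReal (C * δ ^ a) := by
          refine setLIntegral_mono' ((hE.inter measurableSet_Iio).inter measurableSet_Ioi) ?_
          intro r hr
          have hr0 : 0 < r := hr.2
          have hrδ : r < δ := hr.1.2
          rw [← ENNReal.ofReal_mul (Delta_pos hr0).le]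
          refine ENNReal.ofReal_le_ofReal ?_
          have h1 := hΔ r hr0 (hE1 hr.1.1).2.le
          have h2 : 0 < r ^ a := by positivity
          calc Delta α β r * r ^ (-a) ≤ C * (r ^ a) ^ 2 * r ^ (-a) := by gcongr
            _ = C * r ^ a := by rw [Real.rpow_neg hr0.le]; field_simp
            _ ≤ C * δ ^ a := by gcongr
      _ = ENNReal.ofReal (C * δ ^ a) * volume ((E ∩ Iio δ) ∩ Ioi 0) := by
          rw [setLIntegral_const]
      _ ≤ ENNReal.ofReal (C * δ ^ a) * volume (Ioo 0 δ) := by gcongr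
      _ = _ := by
          rw [Real.volume_Ioo, sub_zero, ← ENNReal.ofReal_mul (by positivity),
            Real.rpow_add_one hδ.ne']
          ring_nf
  have hlarge : ∀ δ : ℝ, 0 < δ → ∫⁻ r in E ∩ Ici δ, ENNReal.ofReal (r ^ (-a)) ∂(mu α β)
      ≤ ENNReal.ofReal (δ ^ (-a)) * mu α β E := by
    intro δ hδ
    calc _ ≤ ∫⁻ r in E ∩ Ici δ, ENNReal.ofReal (δ ^ (-a)) ∂(mu α β) := by
          refine setLIntegral_mono' (hE.inter measurableSet_Ici) fun r hr => ?_
          exact ENNReal.ofReal_le_ofReal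
            (Real.rpow_le_rpow_of_nonpos hδ hr.2 (by linarith))
      _ = ENNReal.ofReal (δ ^ (-a)) * mu α β (E ∩ Ici δ) := by rw [setLIntegral_const]
      _ ≤ _ := by gcongr; exact inter_subset_left
  have hfin : mu α β E < ∞ := by
    have h1 : mu α β E = ∫⁻ r in E, 1 ∂(mu α β) := by simp
    rw [h1, lintegral_mu hE]
    calc _ ≤ ∫⁻ r in E ∩ Ioi 0, ENNReal.ofReal C := by
          refine setLIntegral_mono' (hE.inter measurableSet_Ioi) fun r hr => ?_
          rw [mul_one]
          refine ENNReal.ofReal_le_ofReal ((hΔ r hr.2 (hE1 hr.1).2.le).trans ?_)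
          have hr0 : 0 < r := hr.2
          have h2 : r ^ a ≤ 1 := Real.rpow_le_one hr0.le (hE1 hr.1).2.le ha0.le
          have h3 : (r ^ a) ^ 2 ≤ 1 := pow_le_one₀ (by positivity) h2
          nlinarith
      _ ≤ ENNReal.ofReal C * volume (Ioo (0 : ℝ) 1) := by
          rw [setLIntegral_const]
          gcongr
          exact inter_subset_left.trans hE1
      _ < ∞ := ENNReal.mul_lt_top ENNReal.ofReal_lt_top (by simp)
  rcases eq_or_ne (mu α β E) 0 with h0 | h0
  · rw [Measure.restrict_eq_zero.2 h0]; simp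
  set m := (mu α β E).toReal with hm
  have hm0 : 0 < m := ENNReal.toReal_pos h0 hfin.ne
  have hmE : mu α β E = ENNReal.ofReal m := (ENNReal.ofReal_toReal hfin.ne).symm
  -- the cut is made where both parts contribute the same power of `μ(E)`
  set δ := m ^ (1 / (2 * a + 1)) with hδ
  have hδ0 : 0 < δ := by positivity
  have e1 : δ ^ (a + 1) = m ^ (1 / p0 α) := by
    rw [hδ, ← Real.rpow_mul hm0.le, hp]
    congr 1
    ring
  have e2 : δ ^ (-a) * m = m ^ (1 / p0 α) := by
    rw [hδ, ← Real.rpow_mul hm0.le, hp, ← Real.rpow_add_one hm0.ne']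
    congr 1
    field_simp
    ring
  have hsplit : ∫⁻ r in E, ENNReal.ofReal (r ^ (-a)) ∂(mu α β) =
      ∫⁻ r in E ∩ Iio δ, ENNReal.ofReal (r ^ (-a)) ∂(mu α β) +
      ∫⁻ r in E ∩ Ici δ, ENNReal.ofReal (r ^ (-a)) ∂(mu α β) := by
    rw [← lintegral_inter_add_sdiff _ E (measurableSet_Iio (a := δ)), sdiff_eq, compl_Iio]
  have hpow : mu α β E ^ (1 / p0 α) = ENNReal.ofReal (m ^ (1 / p0 α)) := by
    rw [hmE, ENNReal.ofReal_rpow_of_pos hm0]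
  calc _ ≤ ENNReal.ofReal (C * δ ^ (a + 1)) + ENNReal.ofReal (δ ^ (-a)) * mu α β E := by
        rw [hsplit]
        exact add_le_add (hsmall δ hδ0) (hlarge δ hδ0)
    _ = ENNReal.ofReal C * mu α β E ^ (1 / p0 α) + mu α β E ^ (1 / p0 α) := by
        rw [hpow, hmE, ← ENNReal.ofReal_mul (by positivity), e2, e1, ENNReal.ofReal_mul hC.le]
    _ = _ := by
        push_cast
        rw [add_mul, one_mul]
        rfl

lemma lorentzNorm_one {X : Type*} [MeasurableSpace X] (p : ℝ) (f : X → ℂ) (ν : Measure X) :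
    lorentzNorm p 1 f ν = ∫⁻ s in Ioi (0 : ℝ), ν {x | s < ‖f x‖} ^ (1 / p) := by
  rw [lorentzNorm]
  simp only [ENNReal.ofReal_one, one_mul, div_one, ENNReal.rpow_one]
  refine setLIntegral_congr_fun measurableSet_Ioi fun s hs => ?_
  have h1 : ENNReal.ofReal s ≠ 0 := by simpa using hs
  rw [mul_comm, ← mul_assoc, ENNReal.inv_mul_cancel h1 ENNReal.ofReal_ne_top, one_mul]

/-- Duality between `L^{p₀, 1}` and weak `L^{p₀'}`, by the layer cake formula. -/
lemma exists_lintegral_rpow_mul_le (hα : -(1 / 2) < α) (hβ : -(1 / 2) < β) : ∃ C : ℝ≥0,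
    ∀ f : ℝ → ℂ, AEStronglyMeasurable f (mu α β) →
      ∫⁻ r in Ioo 0 1, ENNReal.ofReal (r ^ (-(α + 1 / 2))) * ‖f r‖ₑ ∂(mu α β) ≤
        C * lorentzNorm (p0 α) 1 f (mu α β) := by
  obtain ⟨C, hC⟩ := exists_lintegral_rpow_le hα hβ
  refine ⟨C, fun f hf => ?_⟩
  set w : ℝ → ℝ≥0∞ := fun r => ENNReal.ofReal (r ^ (-(α + 1 / 2))) with hw
  have hwm : Measurable w := by fun_prop
  set η := ((mu α β).restrict (Ioo 0 1)).withDensity w with hη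
  have hac : η ≪ mu α β :=
    (withDensity_absolutelyContinuous _ _).trans Measure.absolutelyContinuous_restrict
  have hfη : AEStronglyMeasurable f η := hf.mono_ac hac
  have h1 : ∫⁻ r in Ioo 0 1, w r * ‖f r‖ₑ ∂(mu α β) = ∫⁻ r, ‖f r‖ₑ ∂η := by
    rw [hη, lintegral_withDensity_eq_lintegral_mul₀ hwm.aemeasurable hf.enorm.restrict]
    rfl
  have h2 : ∫⁻ r, ‖f r‖ₑ ∂η = ∫⁻ s in Ioi (0 : ℝ), η {r | s < ‖f r‖} := by
    rw [← lintegral_eq_lintegral_meas_lt η (Eventually.of_forall fun r => norm_nonneg (f r))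
      hfη.norm.aemeasurable]
    simp only [ofReal_norm]
  rw [h1, h2, lorentzNorm_one]
  have h3 : ∀ A : Set ℝ, η A ≤ C * mu α β A ^ (1 / p0 α) := by
    intro A
    set B := toMeasurable (mu α β) A
    have hB : MeasurableSet B := measurableSet_toMeasurable _ _
    have hp0 : 0 ≤ 1 / p0 α := by
      rw [p0, one_div_div]
      exact div_nonneg (by linarith) (by linarith)
    calc η A ≤ η B := measure_mono (subset_toMeasurable _ _)
      _ = ∫⁻ r in B ∩ Ioo 0 1, w r ∂(mu α β) := by
        rw [hη, withDensity_apply _ hB, Measure.restrict_restrict hB]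
      _ ≤ C * mu α β (B ∩ Ioo 0 1) ^ (1 / p0 α) :=
        hC _ (hB.inter measurableSet_Ioo) inter_subset_right
      _ ≤ C * mu α β B ^ (1 / p0 α) := by gcongr; exact inter_subset_left
      _ = _ := by rw [measure_toMeasurable]
  calc _ ≤ ∫⁻ s in Ioi (0 : ℝ), C * mu α β {r | s < ‖f r‖} ^ (1 / p0 α) :=
        lintegral_mono fun s => h3 _
    _ = _ := lintegral_const_mul' _ _ ENNReal.coe_ne_top

end

/-! ### The maximal operator -/

section

variable {α β : ℝ}

lemma continuousOn_kernel (hα : -(1 / 2) < α) (hβ : -(1 / 2) < β) (hρ : 0 < rho α β)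
    (hαβ : β < α) {R : ℝ} (hR : 0 < R) :
    ContinuousOn (fun p : ℝ × ℝ => kernel α β R p.1 p.2) {p | 0 < p.2 ∧ p.2 < p.1} := by
  -- the weight is only known to be continuous in the strip, so `y` is clamped to `[-1, 1]`
  obtain ⟨z, hz, hzim, hzeq⟩ : ∃ z : ℝ → ℂ, Continuous z ∧ (∀ y, |(z y).im| ≤ 1) ∧
      ∀ y : ℝ, -1 ≤ y → y ≤ 1 → z y = R + y * Complex.I := by
    refine ⟨fun y => R + (max (-1) (min y 1) : ℝ) * Complex.I, by fun_prop, fun y => ?_,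
      fun y h1 h2 => by simp only [min_eq_left h2, max_eq_right h1]⟩
    have : ((R : ℂ) + (max (-1) (min y 1) : ℝ) * Complex.I).im = max (-1) (min y 1) := by simp
    rw [this, abs_le]
    exact ⟨le_max_left _ _, max_le (by norm_num) (min_le_right _ _)⟩
  have hG : Continuous fun y => shiftedWeight α β (z y) :=
    continuous_iff_continuousAt.2 fun y => ContinuousAt.comp
      (f := z) (differentiableAt_shiftedWeight hρ hαβ (hzim y)).continuousAt hz.continuousAt
  have hψ := continuous_psi (β := β) (by linarith : -1 < α)
  have hcd : Continuous fun p : ℝ × ℝ => ∫ y in (-1 : ℝ)..1, cdTerm α β p.1 p.2 (z y) := by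
    refine intervalIntegral.continuous_parametric_intervalIntegral_of_continuous' ?_ _ _
    have c1 : Continuous fun q : (ℝ × ℝ) × ℝ => psi α β (z q.2 + Complex.I) q.1.1 :=
      hψ.comp (f := fun q : (ℝ × ℝ) × ℝ => (z q.2 + Complex.I, q.1.1)) (by fun_prop)
    have c2 : Continuous fun q : (ℝ × ℝ) × ℝ => psi α β (z q.2 - Complex.I) q.1.2 :=
      hψ.comp (f := fun q : (ℝ × ℝ) × ℝ => (z q.2 - Complex.I, q.1.2)) (by fun_prop)
    have c3 : Continuous fun q : (ℝ × ℝ) × ℝ => psi α β (z q.2 - Complex.I) q.1.1 :=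
      hψ.comp (f := fun q : (ℝ × ℝ) × ℝ => (z q.2 - Complex.I, q.1.1)) (by fun_prop)
    have c4 : Continuous fun q : (ℝ × ℝ) × ℝ => psi α β (z q.2 + Complex.I) q.1.2 :=
      hψ.comp (f := fun q : (ℝ × ℝ) × ℝ => (z q.2 + Complex.I, q.1.2)) (by fun_prop)
    exact (hG.comp continuous_snd).mul ((c1.mul c2).sub (c3.mul c4))
  have hne : ∀ p ∈ {p : ℝ × ℝ | 0 < p.2 ∧ p.2 < p.1},
      (Real.sinh p.1 : ℂ) ^ 2 - (Real.sinh p.2 : ℂ) ^ 2 ≠ 0 := by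
    rintro p ⟨h0, h1⟩
    have h2 := Real.sinh_lt_sinh.2 h1
    have h3 := Real.sinh_pos_iff.2 h0
    have h4 : Real.sinh p.2 ^ 2 < Real.sinh p.1 ^ 2 := by gcongr
    have h5 : Real.sinh p.1 ^ 2 - Real.sinh p.2 ^ 2 ≠ 0 := by linarith
    exact_mod_cast h5
  have hs : Continuous fun p : ℝ × ℝ => (Real.sinh p.1 : ℂ) ^ 2 - (Real.sinh p.2 : ℂ) ^ 2 := by
    have := Real.continuous_sinh
    fun_prop
  have hquot : ContinuousOn (fun p : ℝ × ℝ =>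
      ((Real.sinh p.1 : ℂ) ^ 2 - (Real.sinh p.2 : ℂ) ^ 2)⁻¹ *
      (Complex.I * ∫ y in (-1 : ℝ)..1, cdTerm α β p.1 p.2 (z y))) {p | 0 < p.2 ∧ p.2 < p.1} :=
    (hs.continuousOn.inv₀ hne).mul (continuous_const.mul hcd).continuousOn
  refine hquot.congr fun p hp => ?_
  have hid := sinh_sq_sub_mul_kernel hα hβ hρ hαβ (hp.1.trans hp.2) hp.1 hR
  have hzy : ∫ y in (-1 : ℝ)..1, cdTerm α β p.1 p.2 (z y) =
      ∫ y in (-1 : ℝ)..1, cdTerm α β p.1 p.2 (R + y * Complex.I) := by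
    refine intervalIntegral.integral_congr fun y hy => ?_
    rw [uIcc_of_le (by norm_num)] at hy
    simp only [hzeq y hy.1 hy.2]
  beta_reduce
  rw [hzy, ← hid, inv_mul_cancel_left₀ (hne p hp)]

lemma kernel4_of_le {R₀ R t : ℝ} (ht : t ≤ R₀) (r : ℝ) : kernel4 α β R₀ R t r = 0 :=
  indicator_of_notMem (fun h => absurd h.1 (not_lt.2 ht)) _

/-- The region `A₄` contains `r = 0`, which is a null set of `μ`. -/
lemma kernel4_mul_ae_eq {R₀ R t : ℝ} (ht : R₀ < t) (f : ℝ → ℂ) :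
    (fun r => kernel4 α β R₀ R t r * f r) =ᵐ[mu α β]
      (Ioo 0 (R₀ / 2)).indicator fun r => kernel α β R t r * f r := by
  filter_upwards [ae_mu_pos] with r hr
  by_cases h : r < R₀ / 2
  · rw [indicator_of_mem (show r ∈ Ioo 0 (R₀ / 2) from ⟨hr, h⟩), kernel4,
      indicator_of_mem (show (t, r) ∈ region4 R₀ from ⟨ht, hr.le, h⟩)]
  · rw [indicator_of_notMem (fun h' : r ∈ Ioo 0 (R₀ / 2) => h h'.2), kernel4,
      indicator_of_notMem (fun h' : (t, r) ∈ region4 R₀ => h h'.2.2), zero_mul]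

lemma S4_of_lt {R₀ R t : ℝ} (ht : R₀ < t) (f : ℝ → ℂ) :
    S4 α β R₀ R f t = ∫ r in Ioo 0 (R₀ / 2), kernel α β R t r * f r ∂(mu α β) := by
  rw [S4, integral_congr_ae (kernel4_mul_ae_eq ht f), integral_indicator measurableSet_Ioo]

lemma S4_of_le {R₀ R t : ℝ} (ht : t ≤ R₀) (f : ℝ → ℂ) : S4 α β R₀ R f t = 0 := by
  simp [S4, kernel4_of_le ht]

lemma integrable_rpow_mul_norm {f : ℝ → ℂ} (hf : AEStronglyMeasurable f (mu α β))
    (hN : ∫⁻ r in Ioo 0 1, ENNReal.ofReal (r ^ (-(α + 1 / 2))) * ‖f r‖ₑ ∂(mu α β) < ∞) :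
    IntegrableOn (fun r => r ^ (-(α + 1 / 2)) * ‖f r‖) (Ioo 0 1) (mu α β) := by
  refine ⟨AEStronglyMeasurable.mul (by fun_prop) hf.norm.restrict, ?_⟩
  refine lt_of_le_of_lt (setLIntegral_mono' measurableSet_Ioo fun r hr => ?_) hN
  rw [enorm_mul, enorm_norm, Real.enorm_of_nonneg (Real.rpow_nonneg hr.1.le _)]

lemma aestronglyMeasurable_kernel_mul (hα : -(1 / 2) < α) (hβ : -(1 / 2) < β) (hρ : 0 < rho α β)
    (hαβ : β < α) {R₀ R t : ℝ} (hR₀ : 0 < R₀) (hR : 0 < R) (ht : R₀ < t) {f : ℝ → ℂ}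
    (hf : AEStronglyMeasurable f (mu α β)) :
    AEStronglyMeasurable (fun r => kernel α β R t r * f r)
      ((mu α β).restrict (Ioo 0 (R₀ / 2))) := by
  refine AEStronglyMeasurable.mul (ContinuousOn.aestronglyMeasurable ?_ measurableSet_Ioo)
    hf.restrict
  exact (continuousOn_kernel hα hβ hρ hαβ hR).comp (f := fun r => (t, r)) (by fun_prop)
    fun r hr => ⟨hr.1, by linarith [hr.2]⟩

lemma integrable_kernel4_mul (hα : -(1 / 2) < α) (hβ : -(1 / 2) < β) (hρ : 0 < rho α β)
    (hαβ : β < α) {R₀ R : ℝ} (hR₀ : 1 < R₀) (hR₀' : R₀ ≤ 2) (hR : 0 < R) {f : ℝ → ℂ}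
    (hf : AEStronglyMeasurable f (mu α β))
    (hN : ∫⁻ r in Ioo 0 1, ENNReal.ofReal (r ^ (-(α + 1 / 2))) * ‖f r‖ₑ ∂(mu α β) < ∞) (t : ℝ) :
    Integrable (fun r => kernel4 α β R₀ R t r * f r) (mu α β) := by
  rcases le_or_gt t R₀ with ht | ht
  · simp [kernel4_of_le ht]
  obtain ⟨C, hC, hK⟩ := exists_norm_kernel_le hα hβ hρ hαβ
  rw [integrable_congr (kernel4_mul_ae_eq ht f), integrable_indicator_iff measurableSet_Ioo]
  have hdom := ((integrable_rpow_mul_norm hf hN).mono_set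
    (Ioo_subset_Ioo_right (by linarith : R₀ / 2 ≤ 1))).const_mul (C * (t * sqrtDelta α β t)⁻¹)
  refine hdom.mono' (aestronglyMeasurable_kernel_mul hα hβ hρ hαβ (by linarith) hR ht hf) ?_
  filter_upwards [ae_restrict_mem measurableSet_Ioo] with r hr
  rw [norm_mul, ← mul_assoc]
  gcongr
  exact hK R t r hR (by linarith) hr.1 (by linarith [hr.2]) (by linarith [hr.2])

lemma continuousOn_S4 (hα : -(1 / 2) < α) (hβ : -(1 / 2) < β) (hρ : 0 < rho α β)
    (hαβ : β < α) {R₀ R : ℝ} (hR₀ : 1 < R₀) (hR₀' : R₀ ≤ 2) (hR : 0 < R) {f : ℝ → ℂ}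
    (hf : AEStronglyMeasurable f (mu α β))
    (hN : ∫⁻ r in Ioo 0 1, ENNReal.ofReal (r ^ (-(α + 1 / 2))) * ‖f r‖ₑ ∂(mu α β) < ∞) :
    ContinuousOn (S4 α β R₀ R f) (Ioi R₀) := by
  obtain ⟨C, hC, hK⟩ := exists_norm_kernel_le hα hβ hρ hαβ
  refine ContinuousOn.congr (f := fun t => ∫ r in Ioo 0 (R₀ / 2), kernel α β R t r * f r ∂(mu α β))
    ?_ fun t ht => S4_of_lt ht f
  have hdom := ((integrable_rpow_mul_norm hf hN).mono_set
    (Ioo_subset_Ioo_right (by linarith : R₀ / 2 ≤ 1))).const_mul (C * (R₀ * sqrtDelta α β R₀)⁻¹)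
  refine continuousOn_of_dominated (fun t ht =>
    aestronglyMeasurable_kernel_mul hα hβ hρ hαβ (by linarith) hR ht hf) ?_ hdom ?_
  · intro t ht
    filter_upwards [ae_restrict_mem measurableSet_Ioo] with r hr
    have ht' : R₀ < t := ht
    have hq := sqrtDelta_pos (α := α) (β := β) (by linarith : 0 < R₀)
    have hm := sqrtDelta_mono hα hβ (by linarith : 0 < R₀) ht'.le
    have hr0 : 0 < r := hr.1
    have ht0 : 0 ≤ t := by linarith
    rw [norm_mul, ← mul_assoc]
    gcongr
    refine (hK R t r hR (by linarith) hr.1 (by linarith [hr.2]) (by linarith [hr.2])).trans ?_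
    gcongr
  · filter_upwards [ae_restrict_mem measurableSet_Ioo] with r hr
    refine ContinuousOn.mul ?_ continuousOn_const
    exact (continuousOn_kernel hα hβ hρ hαβ hR).comp (f := fun t => (t, r)) (by fun_prop)
      fun t (ht : R₀ < t) => ⟨hr.1, by linarith [hr.2]⟩

/-- Each `|S_{4,R} f|` is continuous on the open set `t > R₀` and vanishes off it, so that the
supremum over the uncountably many `R` is still lower semicontinuous. -/
lemma measurable_S4max (hα : -(1 / 2) < α) (hβ : -(1 / 2) < β) (hρ : 0 < rho α β)
    (hαβ : β < α) {R₀ : ℝ} (hR₀ : 1 < R₀) (hR₀' : R₀ ≤ 2) {f : ℝ → ℂ}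
    (hf : AEStronglyMeasurable f (mu α β))
    (hN : ∫⁻ r in Ioo 0 1, ENNReal.ofReal (r ^ (-(α + 1 / 2))) * ‖f r‖ₑ ∂(mu α β) < ∞) :
    Measurable (S4max α β R₀ f) := by
  refine LowerSemicontinuous.measurable ?_
  refine lowerSemicontinuous_iSup fun R => lowerSemicontinuous_iSup fun hR => ?_
  intro t c hc
  rcases le_or_gt t R₀ with ht | ht
  · simp [S4_of_le ht] at hc
  · have h := (continuousOn_S4 hα hβ hρ hαβ hR₀ hR₀' hR hf hN).continuousAt (Ioi_mem_nhds ht)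
    exact h.enorm.eventually (lt_mem_nhds hc)

lemma exists_S4max_le (hα : -(1 / 2) < α) (hβ : -(1 / 2) < β) (hρ : 0 < rho α β) (hαβ : β < α)
    {R₀ : ℝ} (hR₀ : 1 < R₀) (hR₀' : R₀ ≤ 2) : ∃ C : ℝ, 0 < C ∧ ∀ (f : ℝ → ℂ) (t : ℝ),
    S4max α β R₀ f t ≤ (Ioi R₀).indicator
      (fun t => ENNReal.ofReal (C * (t * sqrtDelta α β t)⁻¹)) t *
      ∫⁻ r in Ioo 0 1, ENNReal.ofReal (r ^ (-(α + 1 / 2))) * ‖f r‖ₑ ∂(mu α β) := by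
  obtain ⟨C, hC, hK⟩ := exists_norm_kernel_le hα hβ hρ hαβ
  refine ⟨C, hC, fun f t => iSup₂_le fun R hR => ?_⟩
  rcases le_or_gt t R₀ with ht | ht
  · simp [S4_of_le ht]
  rw [indicator_of_mem (show t ∈ Ioi R₀ from ht), S4_of_lt ht]
  calc _ ≤ ∫⁻ r in Ioo 0 (R₀ / 2), ‖kernel α β R t r * f r‖ₑ ∂(mu α β) :=
        enorm_integral_le_lintegral_enorm _
    _ ≤ ∫⁻ r in Ioo 0 (R₀ / 2), ENNReal.ofReal (C * (t * sqrtDelta α β t)⁻¹) *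
          (ENNReal.ofReal (r ^ (-(α + 1 / 2))) * ‖f r‖ₑ) ∂(mu α β) := by
        refine setLIntegral_mono' measurableSet_Ioo fun r hr => ?_
        have hq := sqrtDelta_pos (α := α) (β := β) (by linarith : 0 < t)
        have ht0 : 0 < t := by linarith
        rw [enorm_mul, ← mul_assoc, ← ENNReal.ofReal_mul (by positivity), ← ofReal_norm]
        gcongr
        exact hK R t r hR (by linarith) hr.1 (by linarith [hr.2]) (by linarith [hr.2])
    _ ≤ ∫⁻ r in Ioo 0 1, ENNReal.ofReal (C * (t * sqrtDelta α β t)⁻¹) *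
          (ENNReal.ofReal (r ^ (-(α + 1 / 2))) * ‖f r‖ₑ) ∂(mu α β) :=
        lintegral_mono_set (Ioo_subset_Ioo_right (by linarith))
    _ = _ := lintegral_const_mul' _ _ ENNReal.ofReal_ne_top

/-- The function `1 / (t Δ(t)^{1/2})` is square integrable on `t > R₀` with respect to `Δ(t) dt`,
since its square against `μ` is `dt / t²`. -/
lemma eLpNorm_indicator_lt_top {R₀ : ℝ} (hR₀ : 0 < R₀) (C : ℝ) :
    eLpNorm ((Ioi R₀).indicator fun t => ENNReal.ofReal (C * (t * sqrtDelta α β t)⁻¹)) 2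
      (mu α β) < ∞ := by
  rw [eLpNorm_lt_top_iff_lintegral_rpow_enorm_lt_top two_ne_zero ENNReal.ofNat_ne_top]
  simp only [enorm_eq_self, ENNReal.toReal_ofNat]
  have h1 : ∀ t, (Ioi R₀).indicator (fun t => ENNReal.ofReal (C * (t * sqrtDelta α β t)⁻¹)) t
      ^ (2 : ℝ) = (Ioi R₀).indicator
        (fun t => ENNReal.ofReal (C * (t * sqrtDelta α β t)⁻¹) ^ (2 : ℝ)) t := by
    intro t
    by_cases h : t ∈ Ioi R₀
    · simp [h]
    · simp [h]
  simp only [h1]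
  rw [lintegral_indicator measurableSet_Ioi, lintegral_mu measurableSet_Ioi,
    inter_eq_left.2 (Ioi_subset_Ioi hR₀.le)]
  have hint : IntegrableOn (fun t : ℝ => C ^ 2 * t ^ (-2 : ℝ)) (Ioi R₀) :=
    (integrableOn_Ioi_rpow_of_lt (by norm_num) hR₀).const_mul _
  refine lt_of_le_of_lt (setLIntegral_mono' measurableSet_Ioi fun t ht => ?_) hint.2
  have ht0 : 0 < t := hR₀.trans ht
  have hq := sqrtDelta_pos (α := α) (β := β) ht0
  rw [Real.enorm_of_nonneg (by positivity), ENNReal.rpow_two]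
  rcases le_or_gt C 0 with hC | hC
  · rw [ENNReal.ofReal_of_nonpos (mul_nonpos_of_nonpos_of_nonneg hC (by positivity))]
    simp
  rw [← ENNReal.ofReal_pow (by positivity), ← ENNReal.ofReal_mul (Delta_pos ht0).le,
    ← sqrtDelta_sq ht0]
  refine ENNReal.ofReal_le_ofReal (le_of_eq ?_)
  simp only [Real.rpow_neg ht0.le, Real.rpow_two]
  field_simp

end

end JacobiDisc

end

theorem mainTheorem7 (α β R₀ : ℝ) (hβ : -(1 / 2) < β) (hαβ : β < α)
    (hR₀ : 1 < R₀) (hR₀' : R₀ < Real.sqrt (Real.pi / 2)) :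
    ∃ C : ℝ≥0, ∀ f : ℝ → ℂ,
      JacobiDisc.MemLorentz (JacobiDisc.p0 α) 1 f (JacobiDisc.mu α β) →
        (∀ R : ℝ, 0 < R → ∀ t : ℝ,
          Integrable (fun r => JacobiDisc.kernel4 α β R₀ R t r * f r) (JacobiDisc.mu α β)) ∧
        MemLp (JacobiDisc.S4max α β R₀ f) 2 (JacobiDisc.mu α β) ∧
        eLpNorm (JacobiDisc.S4max α β R₀ f) 2 (JacobiDisc.mu α β) ≤
          C * JacobiDisc.lorentzNorm (JacobiDisc.p0 α) 1 f (JacobiDisc.mu α β) := by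
  have hα : -(1 / 2) < α := hβ.trans hαβ
  have hρ : 0 < JacobiDisc.rho α β := by unfold JacobiDisc.rho; linarith
  have hR₀2 : R₀ ≤ 2 := by
    refine hR₀'.le.trans (Real.sqrt_le_iff.2 ⟨by norm_num, ?_⟩)
    linarith [Real.pi_lt_four]
  obtain ⟨C₁, hC₁⟩ := JacobiDisc.exists_lintegral_rpow_mul_le hα hβ
  obtain ⟨C₂, -, hC₂⟩ := JacobiDisc.exists_S4max_le hα hβ hρ hαβ hR₀ hR₀2
  have hfin := JacobiDisc.eLpNorm_indicator_lt_top (α := α) (β := β) (zero_lt_one.trans hR₀) C₂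
  set w : ℝ → ℝ≥0∞ := (Ioi R₀).indicator
    fun t => ENNReal.ofReal (C₂ * (t * JacobiDisc.sqrtDelta α β t)⁻¹) with hw
  set A := eLpNorm w 2 (JacobiDisc.mu α β) with hA
  refine ⟨A.toNNReal * C₁, fun f hf => ?_⟩
  have hLor := hC₁ f hf.1
  set N := ∫⁻ r in Ioo 0 1, ENNReal.ofReal (r ^ (-(α + 1 / 2))) * ‖f r‖ₑ ∂(JacobiDisc.mu α β)
    with hN
  have hNfin : N < ∞ := hLor.trans_lt (ENNReal.mul_lt_top ENNReal.coe_lt_top hf.2)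
  have hmeas := JacobiDisc.measurable_S4max hα hβ hρ hαβ hR₀ hR₀2 hf.1 hNfin
  have hbound : eLpNorm (JacobiDisc.S4max α β R₀ f) 2 (JacobiDisc.mu α β) ≤ A * N := by
    have h := eLpNorm_le_nnreal_smul_eLpNorm_of_ae_le_mul' (μ := JacobiDisc.mu α β)
      (f := JacobiDisc.S4max α β R₀ f) (g := w) (c := N.toNNReal)
      (Filter.Eventually.of_forall fun t => by
        rw [enorm_eq_self, enorm_eq_self, ENNReal.coe_toNNReal hNfin.ne, mul_comm]
        exact hC₂ f t) 2
    rw [ENNReal.smul_def, ENNReal.coe_toNNReal hNfin.ne, smul_eq_mul, mul_comm] at h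
    exact h
  have hfinal : A * N ≤ (A.toNNReal * C₁ : ℝ≥0) *
      JacobiDisc.lorentzNorm (JacobiDisc.p0 α) 1 f (JacobiDisc.mu α β) := by
    rw [ENNReal.coe_mul, ENNReal.coe_toNNReal hfin.ne, mul_assoc]
    gcongr
  exact ⟨fun R hR t => JacobiDisc.integrable_kernel4_mul hα hβ hρ hαβ hR₀ hR₀2 hR hf.1 hNfin t,
    ⟨hmeas.aestronglyMeasurable, hbound.trans_lt (ENNReal.mul_lt_top hfin hNfin)⟩,
    hbound.trans hfinal⟩
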